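/- For every $\varepsilon\in(0,1/2)$ there exists $p_0=p_0(\varepsilon)$ such that the following holds for every prime $p\ge p_0$. Let $A\subset\mathbb{F}_p$ be a subset of the field with $p$ elements, let $\ell$ be a positive integer, and let $\beta$ be a real number with $\beta<1/\ell$. Write $A+A=\{a+b: a,b\in A\}$ and $A\cdot A=\{ab: a,b\in A\}$. If $$\max(|A+A|,\,|A\cdot A|)\le(\beta-\varepsilon)\,p,$$ then $$|A|\le\frac{\beta}{2(\ell+1)}\,p.$$ -/

import Mathlib

open scoped Pointwise

/-! The set `A` is replaced by structured models of its additive and multiplicative sides, and the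
two structures are nearly independent by the Gauss sum bound. Averaging the indicator of `A` over
differences from a Bohr-type set `B`, on which the large Fourier characters of `A` are almost
constant, gives a function of bounded Wiener norm whose additive self-convolution is L²-close to
that of `A`. Hence a superlevel set `X` has few popular sums outside `A + A`. Truncation
(`exists_structured_majorant`) gives `F` which is nearly at least `1` on most of `A`, with mass at
most about `|X|`. The same is done in the unit group, giving `H` and `Y`. Two inverse bounds control
the masses. In the field, Pollard's theorem (`min_le_card_popular_sums`) gives `|X|` at most about
`(β - ε)p/2`. In the unit group subgroups intervene: fewer than `n/ℓ` popular products force `|Y|`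
to be at most about `n/(ℓ + 1)`, where `n = p - 1` (`card_le_of_few_popular_sums`). Finally `|A|` is
at most about `∑ F H`, which `abs_card_mul_sum_mul_sub_le` compares with `(∑ F)(∑ H)/n`, at most
about `(β - ε)p/(2(ℓ + 1))`. The saved `ε` absorbs all errors. -/

/-! ### Counting representations as sums -/

section Representations

variable {G : Type*} [AddCommGroup G] [DecidableEq G]

/-- The number of representations of `z` as a sum of an element of `A` and an element of `B`. -/
def repCount (A B : Finset G) (z : G) : ℕ := (A.filter fun x => z - x ∈ B).card

lemma repCount_eq_sum (A B : Finset G) (z : G) :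
    repCount A B z = ∑ x ∈ A, if z - x ∈ B then 1 else 0 := by
  simp [repCount]

lemma repCount_comm (A B : Finset G) (z : G) : repCount A B z = repCount B A z := by
  refine Finset.card_nbij' (fun x => z - x) (fun x => z - x) ?_ ?_ ?_ ?_
  · intro x hx
    simp only [Finset.coe_filter, Set.mem_ofPred_eq] at hx ⊢
    exact ⟨hx.2, by simpa using hx.1⟩
  · intro x hx
    simp only [Finset.coe_filter, Set.mem_ofPred_eq] at hx ⊢
    exact ⟨hx.2, by simpa using hx.1⟩
  · intro x _
    simp
  · intro x _
    simp

lemma repCount_union_left {A A' : Finset G} (h : Disjoint A A') (B : Finset G) (z : G) :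
    repCount (A ∪ A') B z = repCount A B z + repCount A' B z := by
  simp only [repCount_eq_sum, Finset.sum_union h]

lemma repCount_union_right {B B' : Finset G} (h : Disjoint B B') (A : Finset G) (z : G) :
    repCount A (B ∪ B') z = repCount A B z + repCount A B' z := by
  rw [repCount_comm, repCount_union_left h, repCount_comm B, repCount_comm B']

lemma repCount_le_left (A B : Finset G) (z : G) : repCount A B z ≤ A.card :=
  Finset.card_filter_le _ _

lemma repCount_le_right (A B : Finset G) (z : G) : repCount A B z ≤ B.card := by
  rw [repCount_comm]
  exact repCount_le_left _ _ _

lemma sum_repCount [Fintype G] (A B : Finset G) : ∑ z, repCount A B z = A.card * B.card := by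
  simp only [repCount_eq_sum]
  rw [Finset.sum_comm, Finset.card_eq_sum_ones, Finset.sum_mul]
  refine Finset.sum_congr rfl fun x _ => ?_
  refine (Equiv.sum_comp (Equiv.subRight x) (fun z => if z ∈ B then 1 else 0)).trans ?_
  simp

lemma repCount_map_addRight (A B : Finset G) (c z : G) :
    repCount A (B.map (Equiv.addRight c).toEmbedding) z = repCount A B (z - c) := by
  unfold repCount
  congr 1
  ext x
  simp [Finset.mem_map_equiv, sub_eq_add_neg, add_right_comm]

/-- Inclusion-exclusion for `A` and `z - B`, whose intersection counts the representations of `z`.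
-/
lemma card_add_card_le_repCount [Fintype G] (A B : Finset G) (z : G) :
    A.card + B.card ≤ repCount A B z + Fintype.card G := by
  have h1 : (B.map (Equiv.subLeft z).toEmbedding).card = B.card := Finset.card_map _
  have h2 : repCount A B z = (A ∩ B.map (Equiv.subLeft z).toEmbedding).card := by
    unfold repCount
    congr 1
    ext x
    simp [Finset.mem_map_equiv, sub_eq_add_neg, add_comm]
  rw [h2, ← h1, ← Finset.card_union_add_card_inter]
  have := Finset.card_le_univ (A ∪ B.map (Equiv.subLeft z).toEmbedding)
  omega

end Representations

/-! ### Pollard's theorem and popular sums modulo `p` -/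

section Pollard

variable {p : ℕ} [Fact p.Prime]

/-- Otherwise `A` would be invariant under a nonzero difference of elements of `B`, which generates
`ZMod p`. This supplies the translate for the Dyson transform in `pollard`. -/
lemma exists_translate_inter (A B : Finset (ZMod p)) (hA : A.Nonempty) (hA' : A ≠ Finset.univ)
    (hB : 1 < B.card) :
    ∃ c, (∃ b ∈ B, b + c ∈ A) ∧ ∃ b ∈ B, b + c ∉ A := by
  by_contra! H
  obtain ⟨b, hb, b', hb', hne⟩ := Finset.one_lt_card.1 hB
  obtain ⟨a₀, ha₀⟩ := hA
  have step : ∀ a ∈ A, a + (b' - b) ∈ A := fun a ha => by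
    have := H (a - b) ⟨b, hb, by simpa using ha⟩ b' hb'
    convert this using 1
    ring
  have hk : ∀ k : ℕ, a₀ + k * (b' - b) ∈ A := by
    intro k
    induction k with
    | zero => simpa using ha₀
    | succ k ih =>
      have := step _ ih
      convert this using 1
      push_cast
      ring
  refine hA' (Finset.eq_univ_of_forall fun z => ?_)
  have hd : b' - b ≠ 0 := sub_ne_zero.2 hne.symm
  have := hk ((z - a₀) / (b' - b)).val
  rw [ZMod.natCast_zmod_val, div_mul_cancel₀ _ hd] at this
  simpa using this

/-- Pollard's theorem. -/
theorem pollard (B A : Finset (ZMod p)) (t : ℕ) (htA : t ≤ A.card) (htB : t ≤ B.card) :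
    t * min p (A.card + B.card - t) ≤ ∑ z, min t (repCount A B z) := by
  induction hn : B.card using Nat.strong_induction_on generalizing A B t with
  | _ n ih =>
  subst hn
  have hcard : Fintype.card (ZMod p) = p := ZMod.card p
  rcases Nat.eq_zero_or_pos t with rfl | ht0
  · simp
  rcases Nat.lt_or_ge (A.card + B.card - t) p with hlt | hge
  swap
  · have : ∀ z, min t (repCount A B z) = t := fun z => by
      have := card_add_card_le_repCount A B z
      rw [hcard] at this
      omega
    simp only [this, Finset.sum_const, Finset.card_univ, hcard, smul_eq_mul]
    rw [mul_comm]
    exact Nat.mul_le_mul_right _ (min_le_left _ _)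
  rw [min_eq_right hlt.le]
  rcases htB.eq_or_lt with rfl | htB'
  · have : ∀ z, min B.card (repCount A B z) = repCount A B z := fun z =>
      min_eq_right (repCount_le_right _ _ _)
    simp only [this, sum_repCount]
    rw [mul_comm, Nat.add_sub_cancel]
  have hA0 : A.Nonempty := Finset.card_pos.1 (by omega)
  have hA1 : A ≠ Finset.univ := by
    rintro rfl
    rw [Finset.card_univ, hcard] at hlt
    omega
  obtain ⟨c, ⟨b, hb, hbA⟩, b', hb', hbA'⟩ := exists_translate_inter A B hA0 hA1 (by omega)
  set C := B.map (Equiv.addRight c).toEmbedding with hC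
  have hCcard : C.card = B.card := Finset.card_map _
  have hCmem : ∀ x ∈ B, x + c ∈ C := fun x hx => by simp [hC, Finset.mem_map_equiv, hx]
  have hsum : ∑ z, min t (repCount A B z) = ∑ z, min t (repCount A C z) := by
    simp only [hC, repCount_map_addRight]
    exact (Equiv.sum_comp (Equiv.subRight c) (fun z => min t (repCount A B z))).symm
  rw [hsum, ← hCcard]
  have hAsplit : A = (A ∩ C) ∪ (A \ C) := by rw [Finset.union_comm, Finset.sdiff_union_inter]
  have hCsplit : C = (A ∩ C) ∪ (C \ A) := by
    rw [Finset.inter_comm, Finset.union_comm, Finset.sdiff_union_inter]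
  have hdA : Disjoint (A ∩ C) (A \ C) := Finset.disjoint_sdiff_inter A C |>.symm
  have hdC : Disjoint (A ∩ C) (C \ A) := by
    rw [Finset.inter_comm]
    exact (Finset.disjoint_sdiff_inter C A).symm
  have hU : A ∪ C = A ∪ (C \ A) := by simp
  -- Dyson transform: the representations of `z` split exactly between the pairs `(A ∪ C, A ∩ C)`
  -- and `(A \ C, C \ A)`, whose second members are both smaller than `C`.
  have hrep : ∀ z, repCount A C z =
      repCount (A ∪ C) (A ∩ C) z + repCount (A \ C) (C \ A) z := fun z => by
    have e1 : repCount A C z = repCount A (A ∩ C) z + repCount A (C \ A) z := by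
      rw [← repCount_union_right hdC, ← hCsplit]
    have e2 : repCount A (C \ A) z =
        repCount (A ∩ C) (C \ A) z + repCount (A \ C) (C \ A) z := by
      rw [← repCount_union_left hdA, ← hAsplit]
    rw [e1, e2, hU, repCount_union_left Finset.disjoint_sdiff, repCount_comm (C \ A)]
    ring
  have hI1 : 0 < (A ∩ C).card :=
    Finset.card_pos.2 ⟨b + c, Finset.mem_inter.2 ⟨hbA, hCmem _ hb⟩⟩
  have hI2 : 0 < (C \ A).card :=
    Finset.card_pos.2 ⟨b' + c, Finset.mem_sdiff.2 ⟨hCmem _ hb', hbA'⟩⟩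
  have hc1 : (A ∪ C).card + (A ∩ C).card = A.card + C.card := Finset.card_union_add_card_inter _ _
  have hc2 : (A ∩ C).card + (A \ C).card = A.card := Finset.card_inter_add_card_sdiff _ _
  have hc3 : (A ∩ C).card + (C \ A).card = C.card := by
    rw [Finset.inter_comm]
    exact Finset.card_inter_add_card_sdiff _ _
  -- If `i = |A ∩ C| < t`, the truncation level splits as `i + (t - i)`, and the two inductive
  -- bounds `i(t + u)` and `(t - i)u` add up to exactly `t(i + u)`. Otherwise the first pair
  -- suffices.
  rcases Nat.lt_or_ge (A ∩ C).card t with hIt | hIt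
  · have h1 := ih (A ∩ C).card (by omega) (A ∩ C) (A ∪ C) (A ∩ C).card (by omega) le_rfl rfl
    have h2 := ih (C \ A).card (by omega) (C \ A) (A \ C) (t - (A ∩ C).card) (by omega)
      (by omega) rfl
    have hc4 := Finset.card_le_univ (A ∪ C)
    rw [hcard] at hc4
    rw [min_eq_right (by omega)] at h1 h2
    have h3 : ∑ z, min (A ∩ C).card (repCount (A ∪ C) (A ∩ C) z)
        + ∑ z, min (t - (A ∩ C).card) (repCount (A \ C) (C \ A) z)
        ≤ ∑ z, min t (repCount A C z) := by
      rw [← Finset.sum_add_distrib]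
      refine Finset.sum_le_sum fun z _ => ?_
      rw [hrep z]
      omega
    refine le_trans ?_ ((add_le_add h1 h2).trans h3)
    obtain ⟨s, hs⟩ := Nat.exists_eq_add_of_lt hIt
    obtain ⟨u, hu⟩ : ∃ u, A.card + C.card = t + (A ∩ C).card + u :=
      Nat.exists_eq_add_of_le (by omega)
    have r1 : A.card + C.card - t = (A ∩ C).card + u := by omega
    have r2 : (A ∪ C).card + (A ∩ C).card - (A ∩ C).card = t + u := by omega
    have r3 : (A \ C).card + (C \ A).card - (t - (A ∩ C).card) = u := by omega
    have r4 : t - (A ∩ C).card = s + 1 := by omega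
    rw [r1, r2, r3, r4, hs]
    nlinarith
  · have h1 := ih (A ∩ C).card (by omega) (A ∩ C) (A ∪ C) t (by omega) hIt rfl
    rw [hc1, min_eq_right (by omega)] at h1
    refine h1.trans (Finset.sum_le_sum fun z _ => ?_)
    rw [hrep z]
    omega

/-- A robust form of the Cauchy–Davenport inequality, counting only popular sums. -/
theorem min_le_card_popular_sums (X : Finset (ZMod p)) {κ : ℝ} (hκ : 0 < κ) :
    min (p : ℝ) (2 * X.card) ≤
      ((Finset.univ.filter fun z => κ ^ 2 * p ≤ repCount X X z).card : ℝ) + 2 * κ * p + 1 := by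
  set P := Finset.univ.filter fun z => κ ^ 2 * (p : ℝ) ≤ repCount X X z with hP
  have hp0 : (0 : ℝ) < p := by exact_mod_cast (Fact.out : p.Prime).pos
  have hcard : Fintype.card (ZMod p) = p := ZMod.card p
  -- With `t` about `κp`, unpopular sums contribute at most `κ²p · p ≤ t · κp` in total, so dividing
  -- Pollard's bound by `t` loses only `κp`.
  obtain ⟨t, ht⟩ : ∃ t, t = ⌈κ * p⌉₊ := ⟨_, rfl⟩
  have ht1 : κ * p ≤ t := ht ▸ Nat.le_ceil _
  have ht2 : (t : ℝ) < κ * p + 1 := ht ▸ Nat.ceil_lt_add_one (by positivity)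
  have hκp : 0 < κ * p := by positivity
  have ht0 : (0 : ℝ) < t := hκp.trans_le ht1
  rcases Nat.lt_or_ge X.card t with hX | hX
  · have : (X.card : ℝ) + 1 ≤ t := by exact_mod_cast hX
    refine (min_le_right _ _).trans ?_
    have : (0 : ℝ) ≤ P.card := by positivity
    nlinarith
  have h := pollard X X t hX hX
  have h' : (t : ℝ) * min (p : ℝ) (2 * X.card - t) ≤ ∑ z, (min t (repCount X X z) : ℝ) := by
    have e : ((t * min p (X.card + X.card - t) : ℕ) : ℝ) = t * min (p : ℝ) (2 * X.card - t) := by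
      push_cast [Nat.cast_sub (show t ≤ X.card + X.card by omega)]
      rw [two_mul]
    rw [← e]
    exact_mod_cast h
  have hsum : ∑ z, (min t (repCount X X z) : ℝ) ≤ t * P.card + t * (κ * p) := by
    calc ∑ z, (min t (repCount X X z) : ℝ)
        ≤ ∑ z, ((if z ∈ P then (t : ℝ) else 0) + κ ^ 2 * p) := by
          refine Finset.sum_le_sum fun z _ => ?_
          split_ifs with hz
          · have := min_le_left (t : ℝ) (repCount X X z)
            have : 0 ≤ κ ^ 2 * p := by positivity
            linarith
          · simp only [hP, Finset.mem_filter, Finset.mem_univ, true_and, not_le] at hz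
            have := min_le_right (t : ℝ) (repCount X X z)
            linarith
      _ = t * P.card + κ * p * (κ * p) := by
          rw [Finset.sum_add_distrib, Finset.sum_ite_mem, Finset.univ_inter]
          simp only [Finset.sum_const, Finset.card_univ, hcard, nsmul_eq_mul]
          ring
      _ ≤ _ := by gcongr
  have h2 : min (p : ℝ) (2 * X.card - t) ≤ P.card + κ * p := by
    have : (t : ℝ) * min (p : ℝ) (2 * X.card - t) ≤ t * (P.card + κ * p) := by linarith
    exact le_of_mul_le_mul_left this ht0
  rcases min_le_iff.1 h2 with h3 | h3
  · exact (min_le_left _ _).trans (by linarith)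
  · exact (min_le_right _ _).trans (by linarith)

end Pollard

/-! ### Few popular sums in a finite abelian group -/

section PopularSums

variable {G : Type*} [AddCommGroup G] [DecidableEq G]

/-- The elements of `X` most of whose sums with `X` lie in `P` have popular differences. -/
lemma exists_large_subset_popular_differences [Fintype G] (X P : Finset G) {s : ℝ} (hs : 0 < s)
    (hP : ∑ z ∈ Pᶜ, (repCount X X z : ℝ) ≤ s * s) :
    ∃ Y ⊆ X, (X.card : ℝ) - s ≤ Y.card ∧ ∀ x ∈ Y, ∀ x' ∈ Y,
      2 * ((X.card : ℝ) - s) - P.card ≤ (X.filter fun y => y + (x - x') ∈ X).card := by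
  -- At most `s²` pairs have their sum outside `P`, and each rejected `x` accounts for more than `s`
  -- of them, so at most `s` elements are lost.
  refine ⟨X.filter fun x => (X.card : ℝ) - s ≤ (X.filter fun y => x + y ∈ P).card,
    Finset.filter_subset _ _, ?_, ?_⟩
  · have h1 : ∑ x ∈ X, (X.filter fun y => x + y ∉ P).card = ∑ z ∈ Pᶜ, repCount X X z := by
      simp only [repCount, Finset.card_filter]
      rw [Finset.sum_comm (s := Pᶜ)]
      refine Finset.sum_congr rfl fun x _ => ?_
      rw [← Finset.sum_filter, ← Finset.sum_filter, ← Finset.card_eq_sum_ones,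
        ← Finset.card_eq_sum_ones]
      refine Finset.card_nbij' (fun y => x + y) (fun z => z - x) ?_ ?_ ?_ ?_ <;>
        intro y <;> simp +contextual [and_comm]
    have h1' : (∑ x ∈ X, ((X.filter fun y => x + y ∉ P).card : ℝ)) ≤ s * s := by
      refine le_trans (le_of_eq ?_) hP
      exact_mod_cast h1
    have hsplit := Finset.card_filter_add_card_filter_not (s := X)
      (fun x => (X.card : ℝ) - s ≤ (X.filter fun y => x + y ∈ P).card)
    have hsplit' : ((X.filter fun x => (X.card : ℝ) - s ≤ (X.filter fun y => x + y ∈ P).card).card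
        : ℝ) + (X.filter fun x => ¬ (X.card : ℝ) - s ≤ (X.filter fun y => x + y ∈ P).card).card
        = X.card := by exact_mod_cast hsplit
    set Z := X.filter fun x => ¬ (X.card : ℝ) - s ≤ (X.filter fun y => x + y ∈ P).card with hZ
    have h2 : (Z.card : ℝ) * s ≤ s * s := by
      refine le_trans ?_ h1'
      calc (Z.card : ℝ) * s = ∑ x ∈ Z, s := by simp
        _ ≤ ∑ x ∈ Z, ((X.filter fun y => x + y ∉ P).card : ℝ) := by
            refine Finset.sum_le_sum fun x hx => ?_
            have h4 := (Finset.mem_filter.1 hx).2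
            have h5 : ((X.filter fun y => x + y ∈ P).card : ℝ)
                + (X.filter fun y => x + y ∉ P).card = X.card := by
              exact_mod_cast Finset.card_filter_add_card_filter_not (s := X) (fun y => x + y ∈ P)
            linarith
        _ ≤ _ := Finset.sum_le_sum_of_subset_of_nonneg (Finset.filter_subset _ _)
              fun _ _ _ => by positivity
    have h3 := le_of_mul_le_mul_right h2 hs
    linarith
  · intro x hx x' hx'
    have h4 := (Finset.mem_filter.1 hx).2
    have h5 := (Finset.mem_filter.1 hx').2
    have hsub : ∀ u, (X.filter fun y => u + y ∈ P).map (Equiv.addLeft u).toEmbedding ⊆ P :=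
      fun u w hw => by
        obtain ⟨y, hy, rfl⟩ := Finset.mem_map.1 hw
        exact (Finset.mem_filter.1 hy).2
    -- Two translates of large parts of `X` lie in `P` and so overlap; a coincidence `x + y = x' +
    -- y'` represents `x - x'` as `y' - y`.
    have h1 := Finset.card_union_add_card_inter
      ((X.filter fun y => x + y ∈ P).map (Equiv.addLeft x).toEmbedding)
      ((X.filter fun y => x' + y ∈ P).map (Equiv.addLeft x').toEmbedding)
    have h2 := Finset.card_le_card (Finset.union_subset (hsub x) (hsub x'))
    rw [Finset.card_map, Finset.card_map] at h1
    have h3 : ((X.filter fun y => x + y ∈ P).map (Equiv.addLeft x).toEmbedding ∩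
        (X.filter fun y => x' + y ∈ P).map (Equiv.addLeft x').toEmbedding).card
        ≤ (X.filter fun y => y + (x - x') ∈ X).card := by
      refine Finset.card_le_card_of_injOn (fun w => w - x) ?_ fun a _ b _ h => by simpa using h
      intro w hw
      obtain ⟨hw1, hw2⟩ := Finset.mem_inter.1 hw
      obtain ⟨y, hy, rfl⟩ := Finset.mem_map.1 hw1
      obtain ⟨y', hy', he⟩ := Finset.mem_map.1 hw2
      have he' : x' + y' = x + y := he
      have hyy : y + (x - x') = y' := by
        have : y' = x + y - x' := by rw [← he']; abel
        rw [this]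
        abel
      have hyx : (Equiv.addLeft x).toEmbedding y - x = y := by simp
      refine Finset.mem_coe.2 (Finset.mem_filter.2 ⟨?_, ?_⟩)
      · beta_reduce
        rw [hyx]
        exact (Finset.mem_filter.1 hy).1
      · beta_reduce
        rw [hyx, hyy]
        exact (Finset.mem_filter.1 hy').1
    have h1' : ((X.filter fun y => x + y ∈ P).card : ℝ) + (X.filter fun y => x' + y ∈ P).card
        ≤ P.card + (X.filter fun y => y + (x - x') ∈ X).card := by
      exact_mod_cast h1.symm.le.trans (add_le_add h2 h3)
    linarith

/-- If all differences of a nonempty subset `Y` of `X` have more than `|X| / 2 + |X \ Y|`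
representations in `X - X`, then `Y - Y` is a subgroup. -/
lemma exists_addSubgroup_of_popular_differences {X Y : Finset G} (hY : Y.Nonempty)
    (hD : ∀ x ∈ Y, ∀ x' ∈ Y,
      X.card + 2 * (X \ Y).card < 2 * (X.filter fun y => y + (x - x') ∈ X).card) :
    ∃ H : AddSubgroup G, ∀ d, d ∈ H ↔ ∃ a ∈ Y, ∃ b ∈ Y, d = a - b := by
  obtain ⟨x₀, hx₀⟩ := hY
  have hclosed : ∀ a ∈ Y, ∀ b ∈ Y, ∀ a' ∈ Y, ∀ b' ∈ Y,
      ∃ u ∈ Y, ∃ v ∈ Y, a - b - (a' - b') = u - v := by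
    intro a ha b hb a' ha' b' hb'
    -- For each popular `d`, more than half of all `y ∈ X` satisfy `y + d ∈ Y`. Two such majorities
    -- share some `y`, and subtracting its two translates shows `Y - Y` closed under subtraction.
    have hbig : ∀ d, X.card + 2 * (X \ Y).card < 2 * (X.filter fun y => y + d ∈ X).card →
        X.card < 2 * (X.filter fun y => y + d ∈ Y).card := fun d hd => by
      have h3 : (X.filter fun y => y + d ∈ X).card
          ≤ (X.filter fun y => y + d ∈ Y).card + (X.filter fun y => y + d ∈ X \ Y).card := by
        refine (Finset.card_le_card fun y hy => ?_).trans (Finset.card_union_le _ _)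
        simp only [Finset.mem_union, Finset.mem_filter, Finset.mem_sdiff] at hy ⊢
        tauto
      have h4 : (X.filter fun y => y + d ∈ X \ Y).card ≤ (X \ Y).card := by
        refine Finset.card_le_card_of_injOn (fun y => y + d) ?_ fun a _ b _ h => by simpa using h
        intro y hy
        exact (Finset.mem_filter.1 hy).2
      omega
    have h3 := hbig _ (hD a ha b hb)
    have h4 := hbig _ (hD a' ha' b' hb')
    obtain ⟨y, hy⟩ : ((X.filter fun y => y + (a - b) ∈ Y) ∩
        (X.filter fun y => y + (a' - b') ∈ Y)).Nonempty := by
      rw [← Finset.card_pos]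
      have h5 := Finset.card_union_add_card_inter (X.filter fun y => y + (a - b) ∈ Y)
        (X.filter fun y => y + (a' - b') ∈ Y)
      have h6 := Finset.card_le_card (Finset.union_subset
        (Finset.filter_subset (fun y => y + (a - b) ∈ Y) X)
        (Finset.filter_subset (fun y => y + (a' - b') ∈ Y) X))
      omega
    obtain ⟨hy1, hy2⟩ := Finset.mem_inter.1 hy
    refine ⟨_, (Finset.mem_filter.1 hy1).2, _, (Finset.mem_filter.1 hy2).2, ?_⟩
    abel
  refine ⟨
    { carrier := {d | ∃ a ∈ Y, ∃ b ∈ Y, d = a - b}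
      zero_mem' := ⟨x₀, hx₀, x₀, hx₀, by simp⟩
      neg_mem' := ?_
      add_mem' := ?_ }, fun d => Iff.rfl⟩
  · rintro d d' ⟨a, ha, b, hb, rfl⟩ ⟨a', ha', b', hb', rfl⟩
    obtain ⟨u, hu, v, hv, h⟩ := hclosed a ha b hb b' hb' a' ha'
    exact ⟨u, hu, v, hv, by rw [← h]; abel⟩
  · rintro d ⟨a, ha, b, hb, rfl⟩
    exact ⟨b, hb, a, ha, by simp⟩

lemma sum_card_filter_add_mem [Fintype G] (X : Finset G) :
    ∑ d, (X.filter fun y => y + d ∈ X).card = X.card * X.card := by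
  simp only [Finset.card_filter]
  rw [Finset.sum_comm, Finset.card_eq_sum_ones, Finset.sum_mul]
  refine Finset.sum_congr rfl fun y _ => ?_
  refine (Equiv.sum_comp (Equiv.addLeft y) (fun z => if z ∈ X then 1 else 0)).trans ?_
  simp

/-- Two large subsets of a coset of `S` have every element of the sum coset as a popular sum. -/
lemma two_mul_card_le_card_add_repCount {Y S : Finset G} {H : AddSubgroup G}
    (hS : ∀ d, d ∈ S ↔ d ∈ H) (hH : ∀ a ∈ Y, ∀ b ∈ Y, a - b ∈ H) {x₀ : G} (hx₀ : x₀ ∈ Y)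
    {h : G} (hh : h ∈ H) : 2 * Y.card ≤ S.card + repCount Y Y (x₀ + x₀ + h) := by
  have h1 : (Y ∩ Y.map (Equiv.subLeft (x₀ + x₀ + h)).toEmbedding).card
      ≤ repCount Y Y (x₀ + x₀ + h) := by
    refine Finset.card_le_card fun y hy => ?_
    obtain ⟨hy1, hy2⟩ := Finset.mem_inter.1 hy
    obtain ⟨w, hw, rfl⟩ := Finset.mem_map.1 hy2
    exact Finset.mem_filter.2 ⟨hy1, by simpa using hw⟩
  -- The reflection `y ↦ 2x₀ + h - y` preserves the coset `x₀ + H`, so `Y` and its reflection lie in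
  -- one set of size `|S|`.
  have h2 : (Y ∪ Y.map (Equiv.subLeft (x₀ + x₀ + h)).toEmbedding).card ≤ S.card := by
    refine Finset.card_le_card_of_injOn (fun y => y - x₀) ?_ fun a _ b _ h => by simpa using h
    intro y hy
    refine (hS _).2 ?_
    rcases Finset.mem_union.1 hy with hy | hy
    · exact hH y hy x₀ hx₀
    · obtain ⟨w, hw, rfl⟩ := Finset.mem_map.1 hy
      have : (Equiv.subLeft (x₀ + x₀ + h)).toEmbedding w - x₀ = h - (w - x₀) := by
        rw [Equiv.toEmbedding_apply, Equiv.subLeft_apply]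
        abel
      beta_reduce
      rw [this]
      exact H.sub_mem hh (hH w hw x₀ hx₀)
  have h3 := Finset.card_union_add_card_inter Y (Y.map (Equiv.subLeft (x₀ + x₀ + h)).toEmbedding)
  rw [Finset.card_map] at h3
  omega

lemma repCount_mono {A A' B B' : Finset G} (hA : A ⊆ A') (hB : B ⊆ B') (z : G) :
    repCount A B z ≤ repCount A' B' z := by
  refine Finset.card_le_card fun x hx => ?_
  obtain ⟨h1, h2⟩ := Finset.mem_filter.1 hx
  exact Finset.mem_filter.2 ⟨hA h1, hB h2⟩

/-- If `X` has few popular sums, then up to a small error `X` is no larger than a subgroup of index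
`ℓ + 1`. -/
theorem card_le_of_few_popular_sums [Fintype G] (X : Finset G) {ℓ : ℕ} (hℓ : 0 < ℓ) {σ : ℝ}
    (hσ : 0 < σ) (hσ1 : σ ≤ 1)
    (hP : (ℓ : ℝ) * (Finset.univ.filter fun z => σ ^ 2 * Fintype.card G ≤ repCount X X z).card
      < Fintype.card G) :
    (X.card : ℝ) ≤ Fintype.card G / ((ℓ : ℝ) + 1) + 4 * σ * Fintype.card G := by
  obtain ⟨P, hPdef⟩ : ∃ P, P = Finset.univ.filter
    fun z => σ ^ 2 * (Fintype.card G : ℝ) ≤ repCount X X z := ⟨_, rfl⟩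
  rw [← hPdef] at hP
  obtain ⟨n, hn⟩ : ∃ n : ℝ, n = Fintype.card G := ⟨_, rfl⟩
  rw [← hn] at hP hPdef ⊢
  have hn0 : 0 < n := by rw [hn]; exact_mod_cast Fintype.card_pos
  obtain ⟨s, hs⟩ : ∃ s, s = σ * n := ⟨_, rfl⟩
  have hs0 : 0 < s := by rw [hs]; positivity
  have hσ2 : σ ^ 2 * n ≤ s := by rw [hs]; nlinarith
  have hnotP : ∀ z, z ∉ P → (repCount X X z : ℝ) < σ ^ 2 * n := fun z hz => by
    simpa [hPdef] using hz
  by_contra! hX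
  rw [mul_assoc, ← hs] at hX
  -- For `ℓ = 1` some `z` is unpopular, and pigeonhole at `z` bounds `2|X|`. For `ℓ ≥ 2`, `n/ℓ ≤
  -- (3/2) · n/(ℓ + 1)`, so popular doubling falls below `3/2` and a subgroup appears.
  rcases (Nat.succ_le_of_lt hℓ).eq_or_lt with rfl | hℓ2
  · have hlt : P.card < Fintype.card G := by
      have : (P.card : ℝ) < Fintype.card G := by simpa [hn] using hP
      exact_mod_cast this
    obtain ⟨z, hz⟩ : ∃ z, z ∉ P := by
      by_contra! h
      rw [Finset.eq_univ_of_forall h, Finset.card_univ] at hlt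
      exact lt_irrefl _ hlt
    have h1 : (X.card : ℝ) + X.card ≤ repCount X X z + n := by
      rw [hn]
      exact_mod_cast card_add_card_le_repCount X X z
    have h2 := hnotP z hz
    norm_num at hX
    linarith
  have hℓR : (2 : ℝ) ≤ ℓ := by exact_mod_cast hℓ2
  have hPX : (P.card : ℝ) < 3 / 2 * (X.card - 4 * s) := by
    have h1 : (P.card : ℝ) < n / ℓ := by
      rw [lt_div_iff₀ (by linarith)]
      linarith
    have h2 : n / ℓ ≤ 3 / 2 * (n / (ℓ + 1)) := by
      rw [div_le_iff₀ (by linarith), show 3 / 2 * (n / ((ℓ : ℝ) + 1)) * ℓ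
        = n * (3 / 2 * ℓ) / (ℓ + 1) by ring, le_div_iff₀ (by linarith)]
      nlinarith
    linarith
  have hq : 0 < n / ((ℓ : ℝ) + 1) := by positivity
  obtain ⟨Y, hYX, hYcard, hD⟩ := exists_large_subset_popular_differences X P hs0 (by
    calc (∑ z ∈ Pᶜ, (repCount X X z : ℝ)) ≤ ∑ z ∈ Pᶜ, σ ^ 2 * n :=
          Finset.sum_le_sum fun z hz => (hnotP z (by simpa using hz)).le
      _ ≤ ∑ z : G, σ ^ 2 * n :=
          Finset.sum_le_sum_of_subset_of_nonneg (Finset.subset_univ _)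
            fun _ _ _ => by positivity
      _ = s * s := by
          rw [Finset.sum_const, Finset.card_univ, nsmul_eq_mul, ← hn, hs]
          ring)
  have hXY : ((X \ Y).card : ℝ) + Y.card = X.card := by
    exact_mod_cast Finset.card_sdiff_add_card_eq_card hYX
  have hD' : ∀ x ∈ Y, ∀ x' ∈ Y,
      (X.card : ℝ) / 2 + 4 * s ≤ (X.filter fun y => y + (x - x') ∈ X).card := by
    intro x hx x' hx'
    have := hD x hx x' hx'
    linarith
  have hYne : Y.Nonempty := by
    rw [← Finset.card_pos]
    have : (0 : ℝ) < Y.card := by linarith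
    exact_mod_cast this
  obtain ⟨H, hH⟩ := exists_addSubgroup_of_popular_differences hYne (by
    intro x hx x' hx'
    have := hD' x hx x' hx'
    have h : (X.card : ℝ) + 2 * (X \ Y).card
      < 2 * (X.filter fun y => y + (x - x') ∈ X).card := by linarith
    exact_mod_cast h)
  have hHmem : ∀ a ∈ Y, ∀ b ∈ Y, a - b ∈ H := fun a ha b hb => (hH _).2 ⟨a, ha, b, hb, rfl⟩
  obtain ⟨x₀, hx₀⟩ := hYne
  classical
  obtain ⟨S, hSdef⟩ : ∃ S : Finset G, S = Finset.univ.filter fun d => d ∈ H := ⟨_, rfl⟩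
  have hSH : ∀ d, d ∈ S ↔ d ∈ H := by simp [hSdef]
  have hS : S.card = Nat.card H := by
    rw [Nat.card_eq_fintype_card, Fintype.card_subtype, hSdef]
  have hSD : (S.card : ℝ) * (X.card / 2 + 4 * s) ≤ X.card * X.card := by
    calc (S.card : ℝ) * (X.card / 2 + 4 * s) = ∑ d ∈ S, ((X.card : ℝ) / 2 + 4 * s) := by
          rw [Finset.sum_const, nsmul_eq_mul]
      _ ≤ ∑ d ∈ S, ((X.filter fun y => y + d ∈ X).card : ℝ) := by
          refine Finset.sum_le_sum fun d hd => ?_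
          obtain ⟨a, ha, b, hb, rfl⟩ := (hH d).1 ((hSH d).1 hd)
          exact hD' a ha b hb
      _ ≤ ∑ d, ((X.filter fun y => y + d ∈ X).card : ℝ) :=
          Finset.sum_le_sum_of_subset_of_nonneg (Finset.subset_univ _)
            fun _ _ _ => by positivity
      _ = _ := by exact_mod_cast sum_card_filter_add_mem X
  have hYS : (Y.card : ℝ) ≤ S.card := by
    have : Y.card ≤ S.card := by
      refine Finset.card_le_card_of_injOn (fun y => y - x₀) ?_ fun a _ b _ h => by simpa using h
      intro y hy
      exact (hSH _).2 (hHmem y hy x₀ hx₀)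
    exact_mod_cast this
  -- Since `|S| ≥ |Y| > n/(ℓ + 1)`, the index is below `ℓ + 1`, and integrality makes it at most
  -- `ℓ`.
  have hℓS : n ≤ ℓ * S.card := by
    have h1 : (H.index : ℝ) * S.card = n := by
      rw [hS, hn, ← Nat.card_eq_fintype_card]
      exact_mod_cast H.index_mul_card
    have h2 : n < (ℓ + 1) * S.card := by
      have : n / ((ℓ : ℝ) + 1) < S.card := by linarith
      rw [div_lt_iff₀ (by linarith)] at this
      linarith
    have h3 : (H.index : ℝ) < ℓ + 1 := by
      by_contra! h
      nlinarith [show (0 : ℝ) ≤ S.card by positivity]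
    have h4 : H.index ≤ ℓ := by
      have : H.index < ℓ + 1 := by exact_mod_cast h3
      omega
    rw [← h1]
    have : (H.index : ℝ) ≤ ℓ := by exact_mod_cast h4
    gcongr
  -- This bound leaves `2|Y| - |S| ≥ 2s ≥ σ²n`, so a whole coset of size at least `n/ℓ` is popular,
  -- contradicting `hP`.
  have hSX : (S.card : ℝ) ≤ 2 * X.card - 4 * s := by
    by_contra! h5
    have : (2 * (X.card : ℝ) - 4 * s) * (X.card / 2 + 4 * s) < X.card * X.card :=
      lt_of_lt_of_le (mul_lt_mul_of_pos_right h5 (by positivity)) hSD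
    nlinarith
  have hSP : S.card ≤ P.card := by
    refine Finset.card_le_card_of_injOn (fun h => x₀ + x₀ + h) ?_ fun a _ b _ h => by simpa using h
    intro h hh
    have hhH : h ∈ H := (hSH h).1 hh
    rw [hPdef]
    refine Finset.mem_coe.2 (Finset.mem_filter.2 ⟨Finset.mem_univ _, ?_⟩)
    have h4 : 2 * (Y.card : ℝ) ≤ S.card + repCount Y Y (x₀ + x₀ + h) := by
      exact_mod_cast two_mul_card_le_card_add_repCount hSH hHmem hx₀ hhH
    have h6 : (repCount Y Y (x₀ + x₀ + h) : ℝ) ≤ repCount X X (x₀ + x₀ + h) := by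
      exact_mod_cast repCount_mono hYX hYX _
    linarith
  have : (S.card : ℝ) ≤ P.card := by exact_mod_cast hSP
  nlinarith

end PopularSums

/-! ### Fourier analysis and the Wiener norm -/

section CharacterSums

open scoped ComplexConjugate

variable {G : Type*} [AddCommGroup G] [Fintype G]

/-- The trigonometric polynomial with coefficients `c`. -/
noncomputable def charSum (c : AddChar G ℂ → ℂ) (x : G) : ℂ := ∑ ψ, c ψ * ψ x

lemma sum_mul_apply_neg_add (ψ φ : AddChar G ℂ) [DecidableEq (AddChar G ℂ)] (z : G) :
    ∑ x, ψ x * φ (z - x) = if ψ = φ then Fintype.card G * φ z else 0 := by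
  have h : ∀ x, ψ x * φ (z - x) = φ z * (ψ - φ) x := fun x => by
    rw [sub_eq_add_neg, AddChar.map_add_eq_mul, AddChar.sub_apply]
    ring
  simp only [h, ← Finset.mul_sum, AddChar.sum_eq_ite, sub_eq_zero]
  split_ifs <;> ring

/-- By orthogonality of characters, convolution multiplies coefficients. -/
lemma sum_charSum_mul_charSum_sub (c d : AddChar G ℂ → ℂ) (z : G) :
    ∑ x, charSum c x * charSum d (z - x) = Fintype.card G * charSum (fun ψ => c ψ * d ψ) z := by
  classical
  simp only [charSum, Finset.sum_mul_sum]
  rw [Finset.sum_comm, Finset.mul_sum]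
  refine Finset.sum_congr rfl fun ψ _ => ?_
  rw [Finset.sum_comm]
  have h : ∀ φ : AddChar G ℂ, ∑ x, c ψ * ψ x * (d φ * φ (z - x))
      = c ψ * d φ * if ψ = φ then Fintype.card G * φ z else 0 := fun φ => by
    rw [← sum_mul_apply_neg_add, Finset.mul_sum]
    exact Finset.sum_congr rfl fun x _ => by ring
  simp only [h, mul_ite, mul_zero, Finset.sum_ite_eq, Finset.mem_univ, if_true]
  ring

lemma conj_charSum (c : AddChar G ℂ → ℂ) (x : G) :
    conj (charSum c x) = charSum (fun ψ => conj (c ψ)) (0 - x) := by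
  simp [charSum, AddChar.map_neg_eq_conj]

/-- Parseval's identity. -/
lemma sum_norm_charSum_sq (c : AddChar G ℂ → ℂ) :
    ∑ x, ‖charSum c x‖ ^ 2 = Fintype.card G * ∑ ψ, ‖c ψ‖ ^ 2 := by
  have h := sum_charSum_mul_charSum_sub c (fun ψ => conj (c ψ)) 0
  simp only [← conj_charSum, Complex.mul_conj'] at h
  simp only [charSum, AddChar.map_zero_eq_one, mul_one] at h
  exact_mod_cast h

/-- The Fourier coefficients of the indicator function of `A`. -/
noncomputable def indicatorCoeff (A : Finset G) (ψ : AddChar G ℂ) : ℂ :=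
  (∑ a ∈ A, ψ (-a)) / Fintype.card G

lemma card_ne_zero_complex : (Fintype.card G : ℂ) ≠ 0 := Nat.cast_ne_zero.2 Fintype.card_ne_zero

lemma card_pos_real : (0 : ℝ) < Fintype.card G := Nat.cast_pos.2 Fintype.card_pos

lemma charSum_indicatorCoeff [DecidableEq G] (A : Finset G) (x : G) :
    charSum (indicatorCoeff A) x = if x ∈ A then 1 else 0 := by
  simp only [charSum, indicatorCoeff, div_mul_eq_mul_div, Finset.sum_mul]
  rw [← Finset.sum_div, Finset.sum_comm]
  have h : ∀ a : G, ∑ ψ : AddChar G ℂ, ψ (-a) * ψ x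
      = if a = x then (Fintype.card G : ℂ) else 0 := fun a => by
    simp only [← AddChar.map_add_eq_mul, AddChar.sum_apply_eq_ite, neg_add_eq_zero]
  simp only [h, Finset.sum_ite_eq']
  split_ifs
  · exact div_self card_ne_zero_complex
  · simp

lemma norm_sum_apply_neg (A : Finset G) (ψ : AddChar G ℂ) :
    ‖∑ a ∈ A, ψ (-a)‖ = ‖∑ a ∈ A, ψ a‖ := by
  rw [← Complex.norm_conj, map_sum]
  simp [AddChar.map_neg_eq_conj]

lemma sum_norm_indicatorCoeff_sq (A : Finset G) :
    Fintype.card G * ∑ ψ, ‖indicatorCoeff A ψ‖ ^ 2 = A.card := by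
  classical
  rw [← sum_norm_charSum_sq]
  simp only [charSum_indicatorCoeff]
  rw [Finset.card_eq_sum_ones, Nat.cast_sum, ← Finset.sum_filter_add_sum_filter_not _ (· ∈ A)]
  rw [Finset.sum_congr (g := fun _ => (1 : ℝ)) rfl, Finset.sum_congr (g := fun _ => (0 : ℝ))
    (s₁ := Finset.univ.filter (¬ · ∈ A)) rfl] <;> simp +contextual

lemma sum_norm_indicatorCoeff_sq_le (A : Finset G) : ∑ ψ, ‖indicatorCoeff A ψ‖ ^ 2 ≤ 1 := by
  have h := sum_norm_indicatorCoeff_sq A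
  have h1 : (A.card : ℝ) ≤ Fintype.card G := by exact_mod_cast Finset.card_le_univ A
  have h2 := card_pos_real (G := G)
  by_contra! h3
  nlinarith

lemma norm_indicatorCoeff_le_one (A : Finset G) (ψ : AddChar G ℂ) : ‖indicatorCoeff A ψ‖ ≤ 1 := by
  have h := (Finset.single_le_sum (f := fun ψ => ‖indicatorCoeff A ψ‖ ^ 2)
    (fun _ _ => by positivity) (Finset.mem_univ ψ)).trans (sum_norm_indicatorCoeff_sq_le A)
  exact (sq_le_one_iff₀ (norm_nonneg _)).1 h

/-- `f` is a trigonometric polynomial whose coefficients have total mass at most `W`. -/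
def WienerNormLE (f : G → ℝ) (W : ℝ) : Prop :=
  ∃ c : AddChar G ℂ → ℂ, (∀ x, (f x : ℂ) = charSum c x) ∧ ∑ ψ, ‖c ψ‖ ≤ W

lemma WienerNormLE.nonneg {f : G → ℝ} {W : ℝ} (hf : WienerNormLE f W) : 0 ≤ W := by
  obtain ⟨c, -, hc⟩ := hf
  exact (Finset.sum_nonneg fun _ _ => norm_nonneg _).trans hc

lemma WienerNormLE.one : WienerNormLE (fun _ : G => (1 : ℝ)) 1 := by
  classical
  refine ⟨fun ψ => if ψ = 0 then 1 else 0, fun x => ?_, ?_⟩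
  · simp [charSum]
  · simp [apply_ite (norm : ℂ → ℝ)]

lemma WienerNormLE.sub {f g : G → ℝ} {V W : ℝ} (hf : WienerNormLE f V) (hg : WienerNormLE g W) :
    WienerNormLE (fun x => f x - g x) (V + W) := by
  obtain ⟨c, hc, hcV⟩ := hf
  obtain ⟨d, hd, hdW⟩ := hg
  refine ⟨fun ψ => c ψ - d ψ, fun x => ?_, ?_⟩
  · simp only [Complex.ofReal_sub, hc, hd, charSum, sub_mul, Finset.sum_sub_distrib]
  · refine le_trans ?_ (add_le_add hcV hdW)
    rw [← Finset.sum_add_distrib]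
    exact Finset.sum_le_sum fun ψ _ => norm_sub_le _ _

/-- Coefficients of a product convolve, and the ℓ¹ norm is submultiplicative under convolution. -/
lemma WienerNormLE.mul {f g : G → ℝ} {V W : ℝ} (hf : WienerNormLE f V) (hg : WienerNormLE g W) :
    WienerNormLE (fun x => f x * g x) (V * W) := by
  have hV := hf.nonneg
  obtain ⟨c, hc, hcV⟩ := hf
  obtain ⟨d, hd, hdW⟩ := hg
  refine ⟨fun χ => ∑ ψ, c ψ * d (χ - ψ), fun x => ?_, ?_⟩
  · simp only [Complex.ofReal_mul, hc, hd, charSum, Finset.sum_mul]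
    rw [Finset.sum_comm]
    refine Finset.sum_congr rfl fun ψ _ => ?_
    rw [Finset.mul_sum, ← Equiv.sum_comp (Equiv.subRight ψ)]
    refine Finset.sum_congr rfl fun χ _ => ?_
    have : χ x = ψ x * (χ - ψ) x := by
      rw [← AddChar.add_apply, add_sub_cancel]
    rw [this, Equiv.subRight_apply]
    ring
  · calc ∑ χ, ‖∑ ψ, c ψ * d (χ - ψ)‖ ≤ ∑ χ, ∑ ψ, ‖c ψ‖ * ‖d (χ - ψ)‖ :=
          Finset.sum_le_sum fun χ _ => (norm_sum_le _ _).trans (by simp)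
      _ = (∑ ψ, ‖c ψ‖) * ∑ χ, ‖d χ‖ := by
          rw [Finset.sum_comm, Finset.sum_mul]
          refine Finset.sum_congr rfl fun ψ _ => ?_
          rw [← Finset.mul_sum]
          congr 1
          exact Equiv.sum_comp (Equiv.subRight ψ) fun χ => ‖d χ‖
      _ ≤ V * W := mul_le_mul hcV hdW (Finset.sum_nonneg fun _ _ => norm_nonneg _) hV

lemma WienerNormLE.pow {f : G → ℝ} {W : ℝ} (hf : WienerNormLE f W) (m : ℕ) :
    WienerNormLE (fun x => f x ^ m) (W ^ m) := by
  induction m with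
  | zero => simpa using WienerNormLE.one
  | succ m ih => simpa only [pow_succ] using ih.mul hf

/-- Pigeonholing the values of finitely many characters gives a large set on which each of them
is nearly constant. -/
lemma exists_large_almost_constant (Λ : Finset (AddChar G ℂ)) {N : ℕ} (hN : 0 < N) :
    ∃ B : Finset G, B.Nonempty ∧ (Fintype.card G : ℝ) ≤ ((2 * N + 1 : ℝ) ^ 2) ^ Λ.card * B.card ∧
      ∀ ψ ∈ Λ, ∀ b ∈ B, ∀ b' ∈ B, ‖ψ b - ψ b'‖ ≤ 2 / N := by
  classical
  -- The cell of `x` records real and imaginary parts to precision `1/N`, with `(2N + 1)²` options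
  -- per character. `B` is a most populated cell.
  let F : G → Λ → ℤ × ℤ := fun x ψ => (⌊(N : ℝ) * (ψ.1 x).re⌋, ⌊(N : ℝ) * (ψ.1 x).im⌋)
  let T : Finset (Λ → ℤ × ℤ) :=
    Fintype.piFinset fun _ => Finset.Icc (-(N : ℤ)) N ×ˢ Finset.Icc (-(N : ℤ)) N
  have hNR : (0 : ℝ) < N := by exact_mod_cast hN
  have hfl : ∀ t : ℝ, |t| ≤ 1 → ⌊(N : ℝ) * t⌋ ∈ Finset.Icc (-(N : ℤ)) N := fun t ht => by
    rw [abs_le] at ht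
    rw [Finset.mem_Icc, Int.le_floor]
    refine ⟨by push_cast; nlinarith, ?_⟩
    have h1 : ((⌊(N : ℝ) * t⌋ : ℤ) : ℝ) ≤ N := (Int.floor_le _).trans (by nlinarith)
    exact_mod_cast h1
  have hF : ∀ x ∈ (Finset.univ : Finset G), F x ∈ T := fun x _ => by
    refine Fintype.mem_piFinset.2 fun ψ => Finset.mem_product.2 ⟨hfl _ ?_, hfl _ ?_⟩
    · exact (Complex.abs_re_le_norm _).trans (AddChar.norm_apply _ _).le
    · exact (Complex.abs_im_le_norm _).trans (AddChar.norm_apply _ _).le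
  have hTne : T.Nonempty := ⟨F 0, hF 0 (Finset.mem_univ _)⟩
  have hTcard : (T.card : ℝ) = ((2 * N + 1 : ℝ) ^ 2) ^ Λ.card := by
    have h1 : (Finset.Icc (-(N : ℤ)) N).card = 2 * N + 1 := by
      rw [Int.card_Icc]
      omega
    simp only [T, Fintype.card_piFinset, Finset.card_product, h1, Finset.prod_const,
      Finset.card_univ, Fintype.card_coe]
    push_cast
    ring
  have hT0 : (0 : ℝ) < T.card := by exact_mod_cast hTne.card_pos
  obtain ⟨y, -, hy⟩ := Finset.exists_le_card_fiber_of_nsmul_le_card_of_maps_to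
    (b := (Fintype.card G : ℝ) / T.card) hF hTne (by
      rw [nsmul_eq_mul, mul_div_cancel₀ _ hT0.ne', Finset.card_univ])
  rw [div_le_iff₀ hT0, mul_comm, hTcard] at hy
  refine ⟨_, ?_, hy, ?_⟩
  · rw [← Finset.card_pos]
    by_contra! h0
    rw [Nat.le_zero.1 h0] at hy
    have := card_pos_real (G := G)
    simp at hy
  · intro ψ hψ b hb b' hb'
    have e1 : F b = F b' := (Finset.mem_filter.1 hb).2.trans (Finset.mem_filter.1 hb').2.symm
    have e2 := congrFun e1 ⟨ψ, hψ⟩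
    simp only [F, Prod.mk.injEq] at e2
    have hre := Int.abs_sub_lt_one_of_floor_eq_floor e2.1
    have him := Int.abs_sub_lt_one_of_floor_eq_floor e2.2
    rw [← mul_sub, abs_mul, abs_of_pos hNR] at hre him
    have h3 := Complex.norm_le_abs_re_add_abs_im (ψ b - ψ b')
    rw [Complex.sub_re, Complex.sub_im] at h3
    rw [le_div_iff₀ hNR]
    nlinarith

end CharacterSums

/-! ### Smoothing a set by a Bohr-type set -/

section Smoothing

variable {G : Type*} [AddCommGroup G]

/-- The average of the indicator function of `A` over translates by differences from `B`. -/
noncomputable def smoothing [DecidableEq G] (A B : Finset G) (x : G) : ℝ :=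
  (∑ b ∈ B, ∑ b' ∈ B, if x + b - b' ∈ A then 1 else 0) / (B.card : ℝ) ^ 2

/-- The Fourier multiplier of the smoothing operator. -/
noncomputable def smoothingMultiplier (B : Finset G) (ψ : AddChar G ℂ) : ℝ :=
  (‖∑ b ∈ B, ψ b‖ / B.card) ^ 2

section
variable [DecidableEq G]

lemma smoothing_nonneg (A B : Finset G) (x : G) : 0 ≤ smoothing A B x := by
  unfold smoothing
  positivity

lemma smoothing_le_one (A B : Finset G) (x : G) : smoothing A B x ≤ 1 := by
  refine div_le_one_of_le₀ ?_ (by positivity)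
  calc (∑ b ∈ B, ∑ b' ∈ B, if x + b - b' ∈ A then (1 : ℝ) else 0)
      ≤ ∑ b ∈ B, ∑ b' ∈ B, (1 : ℝ) :=
        Finset.sum_le_sum fun b _ => Finset.sum_le_sum fun b' _ => by split_ifs <;> norm_num
    _ = (B.card : ℝ) ^ 2 := by simp [sq]

lemma smoothing_mono {A C : Finset G} (h : C ⊆ A) (B : Finset G) (x : G) :
    smoothing C B x ≤ smoothing A B x := by
  unfold smoothing
  gcongr with b _ b' _
  split_ifs with h1 h2 <;> first | exact absurd (h h1) h2 | norm_num

/-- The sum on the right is `|B|⁻² ∑ r(u)²`, with `r` the representation function of `B + C`; apply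
Cauchy–Schwarz with `∑ r = |B||C|`. -/
lemma card_sq_le_sum_smoothing [Fintype G] {B : Finset G} (hB : B.Nonempty) (C : Finset G) :
    (C.card : ℝ) ^ 2 ≤ Fintype.card G * ∑ x ∈ C, smoothing C B x := by
  have hB0 : (0 : ℝ) < B.card := by exact_mod_cast hB.card_pos
  have h1 : ∑ u, (repCount B C u : ℝ) = B.card * C.card := by exact_mod_cast sum_repCount B C
  have h2 : (B.card : ℝ) ^ 2 * ∑ x ∈ C, smoothing C B x = ∑ u, (repCount B C u : ℝ) ^ 2 := by
    simp only [smoothing]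
    rw [← Finset.sum_div, mul_div_cancel₀ _ (by positivity)]
    have h3 : ∀ u, (repCount B C u : ℝ) ^ 2 = ∑ b ∈ B, ∑ b' ∈ B,
        (if u - b ∈ C then 1 else 0) * (if u - b' ∈ C then 1 else 0) := fun u => by
      rw [sq, repCount_eq_sum]
      push_cast
      rw [Finset.sum_mul_sum]
    simp only [h3]
    rw [Finset.sum_comm, Finset.sum_comm (s := Finset.univ)]
    refine Finset.sum_congr rfl fun b _ => ?_
    rw [Finset.sum_comm, Finset.sum_comm (s := Finset.univ)]
    refine Finset.sum_congr rfl fun b' _ => ?_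
    rw [← Equiv.sum_comp (Equiv.addRight b)]
    simp only [Equiv.coe_addRight, add_sub_cancel_right, ite_mul, one_mul, zero_mul]
    rw [Finset.sum_ite_mem, Finset.univ_inter]
    rfl
  have h4 := sq_sum_le_card_mul_sum_sq (s := Finset.univ) (f := fun u => (repCount B C u : ℝ))
  rw [h1, ← h2, Finset.card_univ] at h4
  have h5 : (B.card : ℝ) ^ 2 * (C.card : ℝ) ^ 2
      ≤ (B.card : ℝ) ^ 2 * (Fintype.card G * ∑ x ∈ C, smoothing C B x) := by linarith
  exact le_of_mul_le_mul_left h5 (by positivity)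

/-- The smoothing is small only on a small part of `A`. -/
lemma card_filter_smoothing_lt [Fintype G] (A : Finset G) {B : Finset G} (hB : B.Nonempty)
    {η : ℝ} (hη : 0 ≤ η) :
    ((A.filter fun x => smoothing A B x < η).card : ℝ) ≤ η * Fintype.card G := by
  obtain ⟨C, hC⟩ : ∃ C, C = A.filter fun x => smoothing A B x < η := ⟨_, rfl⟩
  rw [← hC]
  -- Smoothing only the exceptional set `C` gives still smaller values, so `|C|²/n ≤ η|C|`.
  have h1 := card_sq_le_sum_smoothing hB C
  have h2 : ∑ x ∈ C, smoothing C B x ≤ C.card * η := by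
    rw [← nsmul_eq_mul]
    refine Finset.sum_le_card_nsmul _ _ _ fun x hx => ?_
    rw [hC] at hx
    refine (smoothing_mono ?_ B x).trans (Finset.mem_filter.1 hx).2.le
    rw [hC]
    exact Finset.filter_subset _ _
  have h3 := card_pos_real (G := G)
  rcases (Nat.cast_nonneg (α := ℝ) C.card).eq_or_lt with h0 | h0
  · rw [← h0]
    positivity
  · refine le_of_mul_le_mul_left ?_ h0
    nlinarith

variable [Fintype G]

lemma smoothing_eq_charSum (A B : Finset G) (x : G) :
    (smoothing A B x : ℂ) = charSum (fun ψ => indicatorCoeff A ψ * smoothingMultiplier B ψ) x := by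
  have h1 : (smoothing A B x : ℂ)
      = (∑ b ∈ B, ∑ b' ∈ B, charSum (indicatorCoeff A) (x + b - b')) / (B.card : ℂ) ^ 2 := by
    simp only [charSum_indicatorCoeff, smoothing]
    push_cast
    simp only [apply_ite (Complex.ofReal), Complex.ofReal_one, Complex.ofReal_zero]
  rw [h1]
  simp only [charSum]
  rw [Finset.sum_congr rfl fun b _ => Finset.sum_comm, Finset.sum_comm, Finset.sum_div]
  refine Finset.sum_congr rfl fun ψ _ => ?_
  have h2 : (smoothingMultiplier B ψ : ℂ)
      = (∑ b ∈ B, ψ b) * (∑ b' ∈ B, ψ (-b')) / (B.card : ℂ) ^ 2 := by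
    have : ∑ b' ∈ B, ψ (-b') = (starRingEnd ℂ) (∑ b' ∈ B, ψ b') := by
      rw [map_sum]
      exact Finset.sum_congr rfl fun b' _ => AddChar.map_neg_eq_conj _ _
    rw [this, Complex.mul_conj']
    simp [smoothingMultiplier, div_pow]
  rw [h2, Finset.sum_mul_sum, mul_div_assoc', div_mul_eq_mul_div, Finset.mul_sum, Finset.sum_mul]
  congr 1
  refine Finset.sum_congr rfl fun b _ => ?_
  rw [Finset.mul_sum, Finset.sum_mul]
  refine Finset.sum_congr rfl fun b' _ => ?_
  rw [sub_eq_add_neg, AddChar.map_add_eq_mul, AddChar.map_add_eq_mul]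
  ring

end

lemma smoothingMultiplier_nonneg (B : Finset G) (ψ : AddChar G ℂ) :
    0 ≤ smoothingMultiplier B ψ := sq_nonneg _

variable [Fintype G]

lemma smoothingMultiplier_le_one (B : Finset G) (ψ : AddChar G ℂ) :
    smoothingMultiplier B ψ ≤ 1 := by
  refine pow_le_one₀ (by positivity) (div_le_one_of_le₀ ?_ (by positivity))
  refine (norm_sum_le _ _).trans ?_
  simp

/-- Parseval for the indicator of `B`. It makes the Wiener norm of a smoothing depend only on the
density of `B`. -/
lemma sum_smoothingMultiplier {B : Finset G} (hB : B.Nonempty) :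
    ∑ ψ, smoothingMultiplier B ψ = Fintype.card G / B.card := by
  have hB0 : (0 : ℝ) < B.card := by exact_mod_cast hB.card_pos
  have hn := card_pos_real (G := G)
  have h := sum_norm_indicatorCoeff_sq B
  have h1 : ∀ ψ : AddChar G ℂ, smoothingMultiplier B ψ
      = (Fintype.card G : ℝ) ^ 2 / B.card ^ 2 * ‖indicatorCoeff B ψ‖ ^ 2 := fun ψ => by
    rw [indicatorCoeff, norm_div, norm_sum_apply_neg, smoothingMultiplier, Complex.norm_natCast]
    field_simp
  simp only [h1, ← Finset.mul_sum]
  field_simp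
  linarith

/-- The average of `ψ` over `B` has modulus at least `1 - δ`; Bernoulli's inequality handles its
fourth power. The square of the multiplier is what acts on a self-convolution. -/
lemma one_sub_smoothingMultiplier_sq_le {B : Finset G} (hB : B.Nonempty) {ψ : AddChar G ℂ} {δ : ℝ}
    (hδ : ∀ b ∈ B, ∀ b' ∈ B, ‖ψ b - ψ b'‖ ≤ δ) : 1 - smoothingMultiplier B ψ ^ 2 ≤ 4 * δ := by
  have hB0 : (0 : ℝ) < B.card := by exact_mod_cast hB.card_pos
  obtain ⟨b₀, hb₀⟩ := hB
  have h1 : ‖∑ b ∈ B, (ψ b₀ - ψ b)‖ ≤ B.card * δ := by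
    rw [← nsmul_eq_mul]
    exact (norm_sum_le _ _).trans (Finset.sum_le_card_nsmul _ _ _ fun b hb => hδ _ hb₀ _ hb)
  have h2 : (B.card : ℝ) = ‖∑ b ∈ B, ψ b₀‖ := by simp
  have h3 : (B.card : ℝ) ≤ ‖∑ b ∈ B, ψ b‖ + B.card * δ := by
    rw [Finset.sum_sub_distrib] at h1
    have := norm_sub_norm_le (∑ b ∈ B, ψ b₀) (∑ b ∈ B, ψ b)
    linarith
  have h4 : 1 - δ ≤ ‖∑ b ∈ B, ψ b‖ / B.card := by
    rw [le_div_iff₀ hB0]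
    linarith
  have h0 : 0 ≤ ‖∑ b ∈ B, ψ b‖ / B.card := by positivity
  have hδ0 : 0 ≤ δ := (norm_nonneg _).trans (hδ _ hb₀ _ hb₀)
  rw [smoothingMultiplier]
  set t := ‖∑ b ∈ B, ψ b‖ / B.card
  have h5 := one_add_mul_le_pow (a := t - 1) (by linarith) 4
  rw [← pow_mul]
  norm_num at h5 ⊢
  linarith

lemma wienerNormLE_smoothing [DecidableEq G] (A : Finset G) {B : Finset G} (hB : B.Nonempty) :
    WienerNormLE (smoothing A B) (Fintype.card G / B.card) := by
  refine ⟨_, smoothing_eq_charSum A B, ?_⟩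
  rw [← sum_smoothingMultiplier hB]
  refine Finset.sum_le_sum fun ψ _ => ?_
  rw [norm_mul, Complex.norm_real, Real.norm_of_nonneg (smoothingMultiplier_nonneg B ψ)]
  exact mul_le_of_le_one_left (smoothingMultiplier_nonneg B ψ) (norm_indicatorCoeff_le_one A ψ)

lemma repCount_eq_charSum [DecidableEq G] (A : Finset G) (z : G) :
    (repCount A A z : ℂ) = Fintype.card G * charSum (fun ψ => indicatorCoeff A ψ ^ 2) z := by
  simp only [sq]
  rw [← sum_charSum_mul_charSum_sub]
  simp only [charSum_indicatorCoeff, repCount_eq_sum, ite_mul, one_mul, zero_mul]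
  rw [Finset.sum_ite_mem, Finset.univ_inter]
  push_cast
  rfl

lemma sum_smoothing_mul_eq_charSum [DecidableEq G] (A B : Finset G) (z : G) :
    ((∑ x, smoothing A B x * smoothing A B (z - x) : ℝ) : ℂ) = Fintype.card G *
      charSum (fun ψ => (indicatorCoeff A ψ * smoothingMultiplier B ψ) ^ 2) z := by
  push_cast
  simp only [sq]
  rw [← sum_charSum_mul_charSum_sub]
  simp only [smoothing_eq_charSum]

/-- If the smoothing set `B` is almost invisible to all large Fourier coefficients of `A`, then
smoothing barely changes the additive convolution of `A` with itself. -/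
lemma sum_sq_repCount_sub_smoothing_le [DecidableEq G] (A : Finset G) {B : Finset G} {θ : ℝ}
    (hθ : ∀ ψ, θ ≤ ‖indicatorCoeff A ψ‖ → 1 - smoothingMultiplier B ψ ^ 2 ≤ θ) :
    ∑ z, (repCount A A z - ∑ x, smoothing A B x * smoothing A B (z - x)) ^ 2
      ≤ (Fintype.card G : ℝ) ^ 3 * θ ^ 2 := by
  have hn := card_pos_real (G := G)
  have h1 : ∀ z, (repCount A A z - ∑ x, smoothing A B x * smoothing A B (z - x)) ^ 2
      = (Fintype.card G : ℝ) ^ 2 * ‖charSum (fun ψ => indicatorCoeff A ψ ^ 2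
        * (1 - smoothingMultiplier B ψ ^ 2 : ℝ)) z‖ ^ 2 := fun z => by
    rw [← sq_abs, ← Real.norm_eq_abs, ← Complex.norm_real, Complex.ofReal_sub,
      sum_smoothing_mul_eq_charSum, Complex.ofReal_natCast, repCount_eq_charSum, ← mul_sub,
      norm_mul, Complex.norm_natCast, mul_pow]
    congr 4
    simp only [charSum]
    rw [← Finset.sum_sub_distrib]
    refine Finset.sum_congr rfl fun ψ _ => ?_
    push_cast
    ring
  simp only [h1, ← Finset.mul_sum, sum_norm_charSum_sq]
  have h2 : ∀ ψ : AddChar G ℂ, ‖indicatorCoeff A ψ ^ 2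
      * ((1 - smoothingMultiplier B ψ ^ 2 : ℝ) : ℂ)‖ ^ 2 ≤ θ ^ 2 * ‖indicatorCoeff A ψ‖ ^ 2 := by
    intro ψ
    have h3 : smoothingMultiplier B ψ ^ 2 ≤ 1 :=
      pow_le_one₀ (smoothingMultiplier_nonneg B ψ) (smoothingMultiplier_le_one B ψ)
    have h4 : 0 ≤ smoothingMultiplier B ψ ^ 2 := sq_nonneg _
    have h5 := norm_indicatorCoeff_le_one A ψ
    have h6 := norm_nonneg (indicatorCoeff A ψ)
    -- Either the coefficient is below `θ` or the multiplier defect is at most `θ`; both factors are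
    -- at most `1`.
    have h7 : ‖indicatorCoeff A ψ‖ * (1 - smoothingMultiplier B ψ ^ 2) ≤ θ := by
      rcases le_or_gt θ ‖indicatorCoeff A ψ‖ with h | h
      · have := hθ ψ h
        nlinarith
      · nlinarith
    rw [norm_mul, Complex.norm_real, Real.norm_of_nonneg (by linarith), norm_pow, ← mul_pow]
    refine pow_le_pow_left₀ (mul_nonneg (sq_nonneg _) (by linarith)) ?_ 2
    nlinarith
  have h8 : ∑ ψ : AddChar G ℂ, ‖indicatorCoeff A ψ ^ 2
      * ((1 - smoothingMultiplier B ψ ^ 2 : ℝ) : ℂ)‖ ^ 2 ≤ θ ^ 2 := by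
    refine (Finset.sum_le_sum fun ψ _ => h2 ψ).trans ?_
    rw [← Finset.mul_sum]
    exact mul_le_of_le_one_right (sq_nonneg _) (sum_norm_indicatorCoeff_sq_le A)
  rw [← mul_assoc, ← pow_succ]
  gcongr

/-- Every set is almost contained in the support of a function of bounded Wiener norm whose
superlevel sets have few popular sums outside of the sumset of the original set. -/
theorem exists_structured_function {κ σ η : ℝ} (hκ : 0 < κ) (hσ : 0 < σ) (hη : 0 < η) :
    ∃ W : ℝ, 0 ≤ W ∧ ∀ (G : Type) [AddCommGroup G] [Fintype G] [DecidableEq G] (A : Finset G),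
      ∃ f : G → ℝ, (∀ x, 0 ≤ f x) ∧ (∀ x, f x ≤ 1) ∧ WienerNormLE f W ∧
        (∀ ζ : ℝ, 0 ≤ ζ → ((A.filter fun x => f x < ζ).card : ℝ) ≤ ζ * Fintype.card G) ∧
        ((Finset.univ.filter fun z => σ ^ 2 * Fintype.card G ≤
          repCount (Finset.univ.filter fun x => η ≤ f x) (Finset.univ.filter fun x => η ≤ f x)
            z).card : ℝ) ≤ (A + A).card + κ * Fintype.card G := by
  -- `θ` is tuned to the final Chebyshev bound, `N` makes the multiplier defect `4 · 2/N` at most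
  -- `θ`, and `L` bounds the number of large coefficients through Bessel's inequality.
  obtain ⟨θ, hθ0, hθ⟩ : ∃ θ : ℝ, 0 < θ ∧ θ ^ 2 = κ * (η ^ 2 * σ ^ 2) ^ 2 :=
    ⟨√(κ * (η ^ 2 * σ ^ 2) ^ 2), by positivity, Real.sq_sqrt (by positivity)⟩
  obtain ⟨N, hN⟩ := exists_nat_gt (8 / θ)
  have hN0 : (0 : ℝ) < N := lt_trans (by positivity) hN
  obtain ⟨L, hL⟩ := exists_nat_gt (1 / θ ^ 2)
  refine ⟨((2 * N + 1 : ℝ) ^ 2) ^ L, by positivity, fun G _ _ _ A => ?_⟩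
  have hn := card_pos_real (G := G)
  obtain ⟨Λ, hΛ⟩ : ∃ Λ : Finset (AddChar G ℂ),
    Λ = Finset.univ.filter fun ψ => θ ≤ ‖indicatorCoeff A ψ‖ := ⟨_, rfl⟩
  obtain ⟨B, hB, hBcard, hBΛ⟩ := exists_large_almost_constant Λ
    (show 0 < N by exact_mod_cast hN0)
  have hB0 : (0 : ℝ) < B.card := by exact_mod_cast hB.card_pos
  have hΛL : Λ.card ≤ L := by
    have h1 : (Λ.card : ℝ) * θ ^ 2 ≤ 1 := by
      rw [← nsmul_eq_mul]
      refine (Finset.card_nsmul_le_sum Λ (fun ψ => ‖indicatorCoeff A ψ‖ ^ 2) _ fun ψ hψ => ?_).trans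
        ((Finset.sum_le_sum_of_subset_of_nonneg (Finset.subset_univ _)
          fun _ _ _ => by positivity).trans (sum_norm_indicatorCoeff_sq_le A))
      rw [hΛ] at hψ
      exact pow_le_pow_left₀ hθ0.le (Finset.mem_filter.1 hψ).2 2
    rw [← le_div_iff₀ (by positivity)] at h1
    exact_mod_cast h1.trans hL.le
  refine ⟨smoothing A B, smoothing_nonneg A B, smoothing_le_one A B, ?_,
    fun ζ hζ => card_filter_smoothing_lt A hB hζ, ?_⟩
  · obtain ⟨c, hc, hcW⟩ := wienerNormLE_smoothing A hB
    refine ⟨c, hc, hcW.trans ?_⟩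
    rw [div_le_iff₀ hB0]
    refine hBcard.trans ?_
    gcongr
    nlinarith
  have hmult : ∀ ψ, θ ≤ ‖indicatorCoeff A ψ‖ → 1 - smoothingMultiplier B ψ ^ 2 ≤ θ := by
    intro ψ hψ
    refine (one_sub_smoothingMultiplier_sq_le hB (hBΛ ψ (by simp [hΛ, hψ]))).trans ?_
    rw [div_lt_iff₀ hθ0] at hN
    rw [mul_div_assoc', div_le_iff₀ hN0]
    linarith
  have hL2 := sum_sq_repCount_sub_smoothing_le A hmult
  obtain ⟨X, hX⟩ : ∃ X, X = Finset.univ.filter fun x => η ≤ smoothing A B x := ⟨_, rfl⟩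
  obtain ⟨P, hP⟩ : ∃ P, P = Finset.univ.filter
    fun z => σ ^ 2 * (Fintype.card G : ℝ) ≤ repCount X X z := ⟨_, rfl⟩
  rw [← hX, ← hP]
  -- On `P \ (A + A)` the true convolution vanishes while the smoothed one is at least `η²σ²n`, so
  -- the L² bound limits the number of such points.
  have hbound : ((P \ (A + A)).card : ℝ) * (η ^ 2 * σ ^ 2 * Fintype.card G) ^ 2
      ≤ (Fintype.card G : ℝ) ^ 3 * θ ^ 2 := by
    rw [← nsmul_eq_mul]
    refine (Finset.card_nsmul_le_sum (P \ (A + A)) (fun z =>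
      (repCount A A z - ∑ x, smoothing A B x * smoothing A B (z - x)) ^ 2) _ fun z hz => ?_).trans
      ((Finset.sum_le_sum_of_subset_of_nonneg (Finset.subset_univ _)
        fun _ _ _ => by positivity).trans hL2)
    obtain ⟨hzP, hzA⟩ := Finset.mem_sdiff.1 hz
    rw [hP] at hzP
    have h1 : repCount A A z = 0 := by
      refine Finset.card_eq_zero.2 (Finset.filter_eq_empty_iff.2 fun x hx hzx => hzA ?_)
      exact Finset.mem_add.2 ⟨x, hx, z - x, hzx, by abel⟩
    have h2 : η ^ 2 * repCount X X z ≤ ∑ x, smoothing A B x * smoothing A B (z - x) := by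
      rw [mul_comm, ← nsmul_eq_mul]
      refine (Finset.card_nsmul_le_sum _ (fun x => smoothing A B x * smoothing A B (z - x)) _
        fun x hx => ?_).trans (Finset.sum_le_sum_of_subset_of_nonneg (Finset.subset_univ _)
        fun _ _ _ => mul_nonneg (smoothing_nonneg _ _ _) (smoothing_nonneg _ _ _))
      obtain ⟨h3, h4⟩ := Finset.mem_filter.1 hx
      rw [hX] at h3 h4
      have h5 := (Finset.mem_filter.1 h3).2
      have h6 := (Finset.mem_filter.1 h4).2
      nlinarith
    have h3 := (Finset.mem_filter.1 hzP).2
    rw [h1, Nat.cast_zero, zero_sub, neg_sq]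
    refine pow_le_pow_left₀ (by positivity) ?_ 2
    refine le_trans ?_ h2
    rw [mul_assoc]
    gcongr
  have hsplit : (P.card : ℝ) ≤ (A + A).card + (P \ (A + A)).card := by
    have h1 : P.card ≤ (A + A).card + (P \ (A + A)).card := by
      have := Finset.card_le_card_sdiff_add_card (s := P) (t := A + A)
      omega
    exact_mod_cast h1
  have hfin : ((P \ (A + A)).card : ℝ) ≤ κ * Fintype.card G := by
    rw [hθ] at hbound
    have h1 : 0 < (η ^ 2 * σ ^ 2 * (Fintype.card G : ℝ)) ^ 2 := by positivity
    refine le_of_mul_le_mul_right (hbound.trans (le_of_eq ?_)) h1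
    ring
  linarith

end Smoothing

/-! ### Amplifying the smoothed function -/

section Truncation

/-- A version of `exists_structured_function` in which the structured function is close to `1` on
most of the given set. -/
theorem exists_structured_majorant {κ : ℝ} (hκ : 0 < κ) (hκ1 : κ < 1) :
    ∃ W : ℝ, ∀ (G : Type) [AddCommGroup G] [Fintype G] [DecidableEq G] (A : Finset G),
      ∃ F : G → ℝ, ∃ X : Finset G, (∀ x, 0 ≤ F x) ∧ WienerNormLE F W ∧
        ((A.filter fun x => F x < 1 - κ).card : ℝ) ≤ κ * Fintype.card G ∧
        ∑ x, F x ≤ X.card + κ * Fintype.card G ∧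
        ((Finset.univ.filter fun z => κ ^ 2 * Fintype.card G ≤ repCount X X z).card : ℝ)
          ≤ (A + A).card + κ * Fintype.card G := by
  obtain ⟨m, hm⟩ := exists_pow_lt_of_lt_one hκ (show 1 - κ < 1 by linarith)
  have hm0 : (0 : ℝ) < m + 1 := by positivity
  obtain ⟨W, -, h⟩ := exists_structured_function hκ hκ (show 0 < κ / (m + 1) by positivity)
  refine ⟨1 + (1 + W) ^ m, fun G _ _ _ A => ?_⟩
  obtain ⟨f, hf0, hf1, hfW, hfA, hP⟩ := h G A
  have hpow0 : ∀ x, 0 ≤ (1 - f x) ^ m := fun x => pow_nonneg (by linarith [hf1 x]) _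
  -- Since `(1 - κ)^m < κ`, `f ≥ κ` pushes the new function above `1 - κ`. Where `f < κ/(m + 1)`,
  -- Bernoulli's inequality keeps it at most `mf ≤ κ`, so its mass sits on the superlevel set.
  refine ⟨fun x => 1 - (1 - f x) ^ m, _, fun x => ?_,
    WienerNormLE.one.sub ((WienerNormLE.one.sub hfW).pow m), ?_, ?_, hP⟩
  · have := pow_le_one₀ (n := m) (by linarith [hf1 x]) (show 1 - f x ≤ 1 by linarith [hf0 x])
    linarith
  · refine le_trans ?_ (hfA κ hκ.le)
    have hsub : (A.filter fun x => 1 - (1 - f x) ^ m < 1 - κ) ⊆ A.filter fun x => f x < κ := by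
      intro x hx
      obtain ⟨hxA, hx⟩ := Finset.mem_filter.1 hx
      refine Finset.mem_filter.2 ⟨hxA, ?_⟩
      by_contra! hxκ
      have := pow_le_pow_left₀ (by linarith [hf1 x]) (show 1 - f x ≤ 1 - κ by linarith) m
      linarith
    exact_mod_cast Finset.card_le_card hsub
  · calc ∑ x, (1 - (1 - f x) ^ m)
        ≤ ∑ x, ((if x ∈ Finset.univ.filter (fun x => κ / (m + 1) ≤ f x) then 1 else 0) + κ) := by
          refine Finset.sum_le_sum fun x _ => ?_
          split_ifs with hx
          · linarith [hpow0 x]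
          · simp only [Finset.mem_filter, Finset.mem_univ, true_and, not_le] at hx
            have h1 := one_add_mul_le_pow (a := -f x) (by linarith [hf1 x]) m
            rw [← sub_eq_add_neg] at h1
            rw [lt_div_iff₀ hm0] at hx
            nlinarith [hf0 x]
      _ = _ := by
          rw [Finset.sum_add_distrib, Finset.sum_ite_mem, Finset.univ_inter]
          simp [mul_comm]

end Truncation

/-! ### Near independence of addition and multiplication -/

section GaussSums

variable {p : ℕ} [Fact p.Prime]

/-- Extended by zero, `φ` is a nontrivial multiplicative character and the sum is a Gauss sum of
modulus `√p`. -/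
lemma norm_sum_addChar_mul_le {ψ : AddChar (ZMod p) ℂ} (hψ : ψ ≠ 0)
    {φ : AddChar (Additive (ZMod p)ˣ) ℂ} (hφ : φ ≠ 0) :
    ‖∑ u : Additive (ZMod p)ˣ, ψ (u.toMul : ZMod p) * φ u‖ ≤ √p := by
  let g : (ZMod p)ˣ →* ℂ :=
    { toFun := fun u => φ (Additive.ofMul u)
      map_one' := φ.map_zero_eq_one
      map_mul' := fun u v => φ.map_add_eq_mul (Additive.ofMul u) (Additive.ofMul v) }
  let χ : MulChar (ZMod p) ℂ := MulChar.ofUnitHom g.toHomUnits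
  have hχu : ∀ u : (ZMod p)ˣ, χ u = φ (Additive.ofMul u) := fun u => by
    simp only [χ, MulChar.ofUnitHom_coe]
    rfl
  have hχ : χ ≠ 1 := by
    rintro h
    obtain ⟨u, hu⟩ := AddChar.ne_zero_iff.1 hφ
    refine hu ?_
    have := hχu u.toMul
    rw [h, MulChar.one_apply_coe] at this
    exact this.symm
  have hgauss : ∑ u : Additive (ZMod p)ˣ, ψ (u.toMul : ZMod p) * φ u = gaussSum χ ψ := by
    refine Fintype.sum_of_injective (fun u : Additive (ZMod p)ˣ => (u.toMul : ZMod p))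
      (fun a b h => Additive.toMul.injective (Units.ext h)) _ _ (fun x hx => ?_) fun u => ?_
    · have : ¬ IsUnit x := fun ⟨u, hu⟩ => hx ⟨Additive.ofMul u, hu⟩
      rw [MulChar.map_nonunit χ this, zero_mul]
    · rw [hχu, mul_comm, ofMul_toMul]
  have h1 := gaussSum_mul_gaussSum_eq_card hχ (AddChar.IsPrimitive.of_ne_one hψ)
  rw [← star_gaussSum_eq, ZMod.card] at h1
  have h2 : ‖gaussSum χ ψ‖ ^ 2 = p := by
    have h3 := Complex.mul_conj' (gaussSum χ ψ)
    rw [starRingEnd_apply, h1] at h3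
    exact_mod_cast h3.symm
  rw [hgauss]
  exact Real.le_sqrt_of_sq_le h2.le

/-- Functions of bounded Wiener norm with respect to the additive and the multiplicative structure
are nearly independent. -/
theorem abs_card_mul_sum_mul_sub_le {F : ZMod p → ℝ} {H : Additive (ZMod p)ˣ → ℝ} {V W : ℝ}
    (hF : WienerNormLE F V) (hH : WienerNormLE H W) :
    |(Fintype.card (Additive (ZMod p)ˣ) : ℝ) * ∑ u : Additive (ZMod p)ˣ, F (u.toMul : ZMod p) * H u
      - (∑ u : Additive (ZMod p)ˣ, F (u.toMul : ZMod p)) * ∑ u, H u|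
      ≤ Fintype.card (Additive (ZMod p)ˣ) * (V * W * √p) := by
  have hV := hF.nonneg
  obtain ⟨c, hc, hcV⟩ := hF
  obtain ⟨d, hd, hdW⟩ := hH
  obtain ⟨n, hn⟩ : ∃ n, n = Fintype.card (Additive (ZMod p)ˣ) := ⟨_, rfl⟩
  rw [← hn]
  -- The covariance is bilinear, so it reduces to pairs of characters; it vanishes when either is
  -- trivial, and otherwise equals `n` times a Gauss sum.
  let E : AddChar (ZMod p) ℂ → AddChar (Additive (ZMod p)ˣ) ℂ → ℂ := fun ψ φ =>
    (n : ℂ) * ∑ u : Additive (ZMod p)ˣ, ψ (u.toMul : ZMod p) * φ u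
      - (∑ u : Additive (ZMod p)ˣ, ψ (u.toMul : ZMod p)) * ∑ u, φ u
  have hE : ∀ ψ φ, ‖E ψ φ‖ ≤ n * √p := fun ψ φ => by
    by_cases hφ : φ = 0
    · have : E ψ φ = 0 := by
        simp only [E, hφ, AddChar.zero_apply, mul_one, Finset.sum_const, Finset.card_univ, ← hn,
          nsmul_eq_mul]
        ring
      rw [this, norm_zero]
      positivity
    · have hφ0 : ∑ u, φ u = 0 := AddChar.sum_eq_zero_iff_ne_zero.2 hφ
      by_cases hψ : ψ = 0
      · have : E ψ φ = 0 := by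
          simp only [E, hψ, AddChar.zero_apply, one_mul, hφ0]
          ring
        rw [this, norm_zero]
        positivity
      · simp only [E, hφ0, mul_zero, sub_zero, norm_mul, Complex.norm_natCast]
        gcongr
        exact norm_sum_addChar_mul_le hψ hφ
  have hsum : (((n : ℝ) * ∑ u : Additive (ZMod p)ˣ, F (u.toMul : ZMod p) * H u
      - (∑ u : Additive (ZMod p)ˣ, F (u.toMul : ZMod p)) * ∑ u, H u : ℝ) : ℂ)
      = ∑ ψ, ∑ φ, c ψ * d φ * E ψ φ := by
    have e1 : ∑ u : Additive (ZMod p)ˣ, (F (u.toMul : ZMod p) : ℂ) * H u = ∑ ψ, ∑ φ,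
        c ψ * d φ * ∑ u : Additive (ZMod p)ˣ, ψ (u.toMul : ZMod p) * φ u := by
      simp only [hc, hd, charSum, Finset.sum_mul_sum]
      simp only [Finset.mul_sum]
      rw [Finset.sum_comm]
      refine Finset.sum_congr rfl fun ψ _ => ?_
      rw [Finset.sum_comm]
      exact Finset.sum_congr rfl fun φ _ => Finset.sum_congr rfl fun u _ => by ring
    have e2 : ∑ u : Additive (ZMod p)ˣ, (F (u.toMul : ZMod p) : ℂ)
        = ∑ ψ, c ψ * ∑ u : Additive (ZMod p)ˣ, ψ (u.toMul : ZMod p) := by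
      simp only [hc, charSum, Finset.mul_sum]
      rw [Finset.sum_comm]
    have e3 : ∑ u, (H u : ℂ) = ∑ φ, d φ * ∑ u, φ u := by
      simp only [hd, charSum, Finset.mul_sum]
      rw [Finset.sum_comm]
    push_cast
    rw [e1, e2, e3, Finset.sum_mul_sum, Finset.mul_sum, ← Finset.sum_sub_distrib]
    refine Finset.sum_congr rfl fun ψ _ => ?_
    rw [Finset.mul_sum, ← Finset.sum_sub_distrib]
    refine Finset.sum_congr rfl fun φ _ => ?_
    simp only [E]
    ring
  rw [← Real.norm_eq_abs, ← Complex.norm_real, hsum]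
  calc ‖∑ ψ, ∑ φ, c ψ * d φ * E ψ φ‖ ≤ ∑ ψ, ∑ φ, ‖c ψ‖ * ‖d φ‖ * (n * √p) := by
        refine (norm_sum_le _ _).trans (Finset.sum_le_sum fun ψ _ => (norm_sum_le _ _).trans
          (Finset.sum_le_sum fun φ _ => ?_))
        rw [norm_mul, norm_mul]
        gcongr
        exact hE ψ φ
    _ = (∑ ψ, ‖c ψ‖) * (∑ φ, ‖d φ‖) * (n * √p) := by
        rw [Finset.sum_mul_sum]
        simp only [Finset.sum_mul]
    _ ≤ V * W * (n * √p) := by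
        have : 0 ≤ ∑ φ, ‖d φ‖ := Finset.sum_nonneg fun _ _ => norm_nonneg _
        gcongr
    _ = _ := by ring

end GaussSums

/-! ### Passage to units and the final estimate -/

lemma injective_toMul_val (p : ℕ) :
    Function.Injective fun u : Additive (ZMod p)ˣ => (u.toMul : ZMod p) :=
  fun _ _ h => Additive.toMul.injective (Units.ext h)

/-- The loss of `1` is for a possible `0 ∈ A`. Writing the unit group additively lets the sumset
results apply to products. -/
lemma card_unit_preimage (p : ℕ) [Fact p.Prime] (A : Finset (ZMod p)) :
    ∃ U : Finset (Additive (ZMod p)ˣ), (∀ u, u ∈ U ↔ (u.toMul : ZMod p) ∈ A) ∧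
      A.card ≤ U.card + 1 ∧ (U + U).card ≤ (A * A).card := by
  classical
  refine ⟨Finset.univ.filter fun u => (u.toMul : ZMod p) ∈ A, by simp, ?_, ?_⟩
  · have hsub : A ⊆ insert 0 ((Finset.univ.filter fun u : Additive (ZMod p)ˣ =>
        (u.toMul : ZMod p) ∈ A).image fun u => (u.toMul : ZMod p)) := by
      intro a ha
      rcases eq_or_ne a 0 with rfl | h0
      · exact Finset.mem_insert_self _ _
      · refine Finset.mem_insert_of_mem (Finset.mem_image.2
          ⟨Additive.ofMul (Units.mk0 a h0), ?_, by simp⟩)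
        simpa using ha
    exact (Finset.card_le_card hsub).trans ((Finset.card_insert_le _ _).trans
      (Nat.add_le_add_right Finset.card_image_le 1))
  · refine Finset.card_le_card_of_injOn _ ?_ (injective_toMul_val p).injOn
    intro u hu
    obtain ⟨a, ha, b, hb, rfl⟩ := Finset.mem_add.1 hu
    have ha' := (Finset.mem_filter.1 ha).2
    have hb' := (Finset.mem_filter.1 hb).2
    exact Finset.mem_coe.2 (by simpa using Finset.mul_mem_mul ha' hb')

/-- The numerical computation that ends the proof of the main theorem. -/
lemma le_of_structured_bounds {a z β ε κ ℓ P : ℝ} (hε : 0 < ε) (hκ : κ = ε ^ 2 / 120)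
    (hκε : 240 * κ < ε) (hℓ : 1 ≤ ℓ) (hβℓ : β * ℓ < 1) (hεβ : ε ≤ β) (hP : 0 < P) (hzP : z ≤ P)
    (hz : z * (1 - κ) ^ 2 ≤ ((β - ε) / 2 + 3 * κ) * P * (1 / (ℓ + 1) + 5 * κ) + κ * P)
    (ha : a ≤ z + 3 * (κ * P)) : a ≤ β / (2 * (ℓ + 1)) * P := by
  have hκ0 : 0 < κ := by rw [hκ]; positivity
  have hβ1 : β < 1 := by nlinarith
  obtain ⟨q, hq⟩ : ∃ q : ℝ, q = 1 / (ℓ + 1) := ⟨_, rfl⟩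
  have hq0 : 0 < q := by rw [hq]; positivity
  have hq1 : q ≤ 1 := by
    rw [hq, div_le_one (by linarith)]
    linarith
  have hqε : ε / 2 ≤ q := by
    rw [hq, le_div_iff₀ (by linarith)]
    nlinarith
  have hgoal : β / (2 * (ℓ + 1)) = β / 2 * q := by
    rw [hq]
    field_simp
  rw [hgoal]
  rw [← hq] at hz
  have ha2 : a ≤ (6 * κ + ((β - ε) / 2 + 3 * κ) * (q + 5 * κ)) * P := by
    have h1 : κ * z ≤ κ * P := by gcongr
    have h2 : z ≤ z * (1 - κ) ^ 2 + 2 * (κ * P) := by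
      rcases le_or_gt 0 z with hz0 | hz0
      · nlinarith [mul_nonneg hz0 (sq_nonneg κ)]
      · have : (1 - κ) ^ 2 ≤ 1 := pow_le_one₀ (by linarith) (by linarith)
        nlinarith [mul_pos hκ0 hP]
    linarith
  refine ha2.trans (mul_le_mul_of_nonneg_right ?_ hP.le)
  -- The saving `(ε/2)q` is at least `ε²/4 = 30κ`, while the errors total at most `6κ + 3κ + 5κ + κ
  -- = 15κ`.
  have h1 : ε / 2 * (ε / 2) ≤ ε / 2 * q := by gcongr
  have h2 : (120 : ℝ) * κ = ε ^ 2 := by rw [hκ]; ring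
  have h3 : 3 * κ * q ≤ 3 * κ := by nlinarith
  have h4 : (β - ε) / 2 * (5 * κ) ≤ 5 * κ := by nlinarith
  have h5 : 15 * κ * κ ≤ κ := by nlinarith
  linarith

lemma sum_units_le {p : ℕ} [Fact p.Prime] {F : ZMod p → ℝ} (hF : ∀ x, 0 ≤ F x) :
    ∑ u : Additive (ZMod p)ˣ, F (u.toMul : ZMod p) ≤ ∑ x, F x := by
  refine (Finset.sum_map Finset.univ ⟨_, injective_toMul_val p⟩ F).ge.trans ?_
  exact Finset.sum_le_sum_of_subset_of_nonneg (Finset.subset_univ _) fun x _ _ => hF x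

lemma card_filter_mul_sq_le_sum {ι : Type*} [Fintype ι] (U : Finset ι) {F H : ι → ℝ}
    (hF : ∀ x, 0 ≤ F x) (hH : ∀ x, 0 ≤ H x) {t : ℝ} (ht : 0 ≤ t) :
    ((U.filter fun u => t ≤ F u ∧ t ≤ H u).card : ℝ) * t ^ 2 ≤ ∑ u, F u * H u := by
  rw [← nsmul_eq_mul]
  refine (Finset.card_nsmul_le_sum _ (fun u => F u * H u) _ fun u hu => ?_).trans
    (Finset.sum_le_sum_of_subset_of_nonneg (Finset.subset_univ _)
      fun u _ _ => mul_nonneg (hF _) (hH _))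
  obtain ⟨h1, h2⟩ := (Finset.mem_filter.1 hu).2
  rw [sq]
  exact mul_le_mul h1 h2 ht (hF u)

lemma card_le_card_filter_add {p : ℕ} {A : Finset (ZMod p)} {U : Finset (Additive (ZMod p)ˣ)}
    (F : ZMod p → ℝ) (H : Additive (ZMod p)ˣ → ℝ) (t : ℝ)
    (hUA : ∀ u ∈ U, (u.toMul : ZMod p) ∈ A) :
    U.card ≤ (U.filter fun u => t ≤ F (u.toMul : ZMod p) ∧ t ≤ H u).card
      + (A.filter fun x => F x < t).card + (U.filter fun u => H u < t).card := by
  classical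
  have h1 : U ⊆ ((U.filter fun u => t ≤ F (u.toMul : ZMod p) ∧ t ≤ H u)
      ∪ U.filter fun u => F (u.toMul : ZMod p) < t) ∪ U.filter fun u => H u < t := by
    intro u hu
    simp only [Finset.mem_union, Finset.mem_filter, hu, true_and]
    by_cases h1 : F (u.toMul : ZMod p) < t
    · exact Or.inl (Or.inr h1)
    by_cases h2 : H u < t
    · exact Or.inr h2
    exact Or.inl (Or.inl ⟨not_lt.1 h1, not_lt.1 h2⟩)
  have h2 : (U.filter fun u => F (u.toMul : ZMod p) < t).card
      ≤ (A.filter fun x => F x < t).card := by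
    refine Finset.card_le_card_of_injOn _ ?_ (injective_toMul_val p).injOn
    intro u hu
    obtain ⟨h3, h4⟩ := Finset.mem_filter.1 hu
    exact Finset.mem_coe.2 (Finset.mem_filter.2 ⟨hUA u h3, h4⟩)
  refine (Finset.card_le_card h1).trans ((Finset.card_union_le _ _).trans ?_)
  exact Nat.add_le_add_right ((Finset.card_union_le _ _).trans (Nat.add_le_add_left h2 _)) _

/-- As `ℓ ≥ 1`, the saving `ℓ(ε - κ)P` exceeds `1`. So the popular product bound beats `n/ℓ` for `n
= p - 1`, not merely `p/ℓ`. -/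
lemma mul_lt_sub_one_of_le {β ε κ ℓ P Q : ℝ} (hℓ : 1 ≤ ℓ) (hβℓ : β * ℓ < 1) (hκ : 0 < κ)
    (hκε : 240 * κ < ε) (hκP : 1 ≤ κ * P) (hQ : Q ≤ (β - ε) * P + κ * P) : ℓ * Q < P - 1 := by
  have hP : 0 < P := pos_of_mul_pos_right (by linarith) hκ.le
  have h1 : ℓ * Q ≤ ℓ * ((β - ε) * P + κ * P) := by gcongr
  have h2 : ℓ * (β - ε + κ) ≤ 1 - (ε - κ) := by nlinarith
  have h3 : ℓ * (β - ε + κ) * P ≤ (1 - (ε - κ)) * P := by gcongr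
  have h4 : 240 * κ * P < ε * P := by gcongr
  linarith

theorem theorem2 (ε : ℝ) (hε₀ : 0 < ε) (hε₁ : ε < 1 / 2) :
    ∃ p₀ : ℕ, ∀ p : ℕ, p.Prime → p₀ ≤ p →
      ∀ (A : Finset (ZMod p)) (β : ℝ) (ℓ : ℕ), 0 < ℓ → β < 1 / (ℓ : ℝ) →
        max ((A + A).card : ℝ) ((A * A).card : ℝ) ≤ (β - ε) * (p : ℝ) →
        (A.card : ℝ) ≤ β / (2 * ((ℓ : ℝ) + 1)) * (p : ℝ) := by
  obtain ⟨κ, hκ⟩ : ∃ κ, κ = ε ^ 2 / 120 := ⟨_, rfl⟩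
  have hκ0 : 0 < κ := by rw [hκ]; positivity
  have hκε : 240 * κ < ε := by rw [hκ]; nlinarith
  have hκ1 : κ < 1 := by linarith
  obtain ⟨W, hW⟩ := exists_structured_majorant hκ0 hκ1
  -- The first bound lets `κp` absorb additive constants `1`; the second makes the Gauss sum error
  -- `W²√p` at most `κp`.
  obtain ⟨p₀, hp₀⟩ := exists_nat_gt (max (1 / κ) ((W * W / κ) ^ 2))
  refine ⟨p₀, fun p hp hpp A β ℓ hℓ hβ hmax => ?_⟩
  have : Fact p.Prime := ⟨hp⟩
  obtain ⟨P, hP⟩ : ∃ P : ℝ, P = p := ⟨_, rfl⟩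
  have hP0 : 0 < P := by rw [hP]; exact_mod_cast hp.pos
  have hpP : (p₀ : ℝ) ≤ P := by rw [hP]; exact_mod_cast hpp
  have hκP : 1 ≤ κ * P := by
    have h1 : 1 / κ < P := (le_max_left _ _).trans_lt (hp₀.trans_le hpP)
    rw [div_lt_iff₀ hκ0] at h1
    linarith
  have hWP : W * W * √P ≤ κ * P := by
    have h1 : (W * W / κ) ^ 2 ≤ P := ((le_max_right _ _).trans_lt (hp₀.trans_le hpP)).le
    have h2 : W * W / κ ≤ √P := Real.le_sqrt_of_sq_le h1
    rw [div_le_iff₀ hκ0] at h2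
    calc W * W * √P ≤ √P * κ * √P := by gcongr
      _ = κ * (√P * √P) := by ring
      _ = κ * P := by rw [Real.mul_self_sqrt hP0.le]
  have hℓR : (1 : ℝ) ≤ ℓ := by exact_mod_cast hℓ
  have hβℓ : β * ℓ < 1 := by rwa [lt_div_iff₀ (by linarith)] at hβ
  rw [← hP] at hmax ⊢
  have hsum : ((A + A).card : ℝ) ≤ (β - ε) * P := (le_max_left _ _).trans hmax
  have hprod : ((A * A).card : ℝ) ≤ (β - ε) * P := (le_max_right _ _).trans hmax
  have hεβ : ε ≤ β := by
    have h1 : 0 ≤ (β - ε) * P := (Nat.cast_nonneg _).trans hsum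
    have := nonneg_of_mul_nonneg_left h1 hP0
    linarith
  have hβ1 : β < 1 := by nlinarith
  obtain ⟨n, hn⟩ : ∃ n : ℝ, n = Fintype.card (Additive (ZMod p)ˣ) := ⟨_, rfl⟩
  have hnP : n = P - 1 := by
    have h1 : Fintype.card (Additive (ZMod p)ˣ) = p - 1 := by
      rw [Fintype.card_additive, ZMod.card_units]
    rw [hn, h1, Nat.cast_sub hp.one_le, hP, Nat.cast_one]
  have hnP' : n ≤ P := by rw [hnP]; exact sub_le_self _ zero_le_one
  have hn0 : 0 < n := hn ▸ card_pos_real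
  have hcardp : (Fintype.card (ZMod p) : ℝ) = P := by rw [ZMod.card, hP]
  obtain ⟨U, hUA, hAU, hUU⟩ := card_unit_preimage p A
  obtain ⟨F, X, hF0, hFW, hFA, hFX, hXP⟩ := hW (ZMod p) A
  obtain ⟨H, Y, hH0, hHW, hHU, hHY, hYP⟩ := hW (Additive (ZMod p)ˣ) U
  rw [hcardp] at hFA hFX hXP
  rw [← hn] at hHU hHY hYP
  -- the structured sets are small
  have hX : (X.card : ℝ) ≤ (β - ε + 4 * κ) / 2 * P := by
    have h1 := min_le_card_popular_sums X hκ0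
    rw [← hP] at h1
    have h2 : min P (2 * X.card) ≤ (β - ε + 4 * κ) * P := by linarith
    -- The first alternative is impossible because `β - ε + 4κ < 1`.
    rcases min_le_iff.1 h2 with h3 | h3
    · nlinarith
    · linarith
  have hY : (Y.card : ℝ) ≤ n / (ℓ + 1) + 4 * κ * n := by
    obtain ⟨Q, hQ⟩ : ∃ Q, Q = Finset.univ.filter fun z => κ ^ 2 * n ≤ repCount Y Y z := ⟨_, rfl⟩
    rw [← hQ] at hYP
    have h2 : ((U + U).card : ℝ) ≤ (A * A).card := by exact_mod_cast hUU
    have h3 := mul_lt_sub_one_of_le hℓR hβℓ hκ0 hκε hκP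
      (hYP.trans (add_le_add (h2.trans hprod) (mul_le_mul_of_nonneg_left hnP' hκ0.le)))
    rw [← hnP] at h3
    have h1 := card_le_of_few_popular_sums Y hℓ hκ0 hκ1.le
    rw [← hn, ← hQ] at h1
    exact h1 h3
  -- the structured functions are nearly independent
  have hind := (abs_le.1 (abs_card_mul_sum_mul_sub_le hFW hHW)).2
  rw [← hn, ← hP] at hind
  have hFu : ∑ u : Additive (ZMod p)ˣ, F (u.toMul : ZMod p) ≤ ∑ x, F x :=
    sum_units_le hF0
  have hF' : ∑ u : Additive (ZMod p)ˣ, F (u.toMul : ZMod p) ≤ ((β - ε) / 2 + 3 * κ) * P := by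
    linarith
  have hH' : ∑ u, H u ≤ n * (1 / (ℓ + 1) + 5 * κ) := by
    have : n / ((ℓ : ℝ) + 1) = n * (1 / (ℓ + 1)) := by ring
    linarith
  have hFH : ∑ u : Additive (ZMod p)ˣ, F (u.toMul : ZMod p) * H u
      ≤ ((β - ε) / 2 + 3 * κ) * P * (1 / (ℓ + 1) + 5 * κ) + κ * P := by
    have h1 : (∑ u : Additive (ZMod p)ˣ, F (u.toMul : ZMod p)) * ∑ u, H u
        ≤ ((β - ε) / 2 + 3 * κ) * P * (n * (1 / (ℓ + 1) + 5 * κ)) :=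
      mul_le_mul hF' hH' (Finset.sum_nonneg fun u _ => hH0 u) (mul_nonneg (by linarith) hP0.le)
    have h2 : n * (W * W * √P) ≤ n * (κ * P) := by gcongr
    refine le_of_mul_le_mul_left ?_ hn0
    linarith
  obtain ⟨Z, hZ⟩ : ∃ Z, Z = U.filter
    fun u => 1 - κ ≤ F (u.toMul : ZMod p) ∧ 1 - κ ≤ H u := ⟨_, rfl⟩
  have hZP : (Z.card : ℝ) ≤ P := by
    have : (Z.card : ℝ) ≤ n := by
      rw [hn]
      exact_mod_cast Finset.card_le_univ Z
    linarith
  have hZ1 : (Z.card : ℝ) * (1 - κ) ^ 2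
      ≤ ((β - ε) / 2 + 3 * κ) * P * (1 / (ℓ + 1) + 5 * κ) + κ * P := by
    refine le_trans ?_ hFH
    rw [hZ]
    exact card_filter_mul_sq_le_sum _ (fun u => hF0 _) hH0 (sub_nonneg.2 hκ1.le)
  have hUZ : (U.card : ℝ) ≤ Z.card + κ * P + κ * n := by
    have h1 : (U.card : ℝ) ≤ Z.card + (A.filter fun x => F x < 1 - κ).card
        + (U.filter fun u => H u < 1 - κ).card := by
      rw [hZ]
      exact_mod_cast card_le_card_filter_add F H (1 - κ) fun u => (hUA u).1
    linarith
  have hA : (A.card : ℝ) ≤ U.card + 1 := by exact_mod_cast hAU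
  have hκn : κ * n ≤ κ * P := mul_le_mul_of_nonneg_left hnP' hκ0.le
  -- One `κP` each for the points where `F` is small, those where `H` is small, and the element `0`.
  have hA1 : (A.card : ℝ) ≤ Z.card + 3 * (κ * P) := by linarith
  exact le_of_structured_bounds hε₀ hκ hκε hℓR hβℓ hεβ hP0 hZP hZ1 hA1
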